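/- Let $d\in\mathbb N$, let $n$ be an integer with $0<n<d$, and let $s>n$ be real. Let $\mathcal G(d,n)$ be the Grassmannian of $n$-dimensional linear subspaces of $\mathbb R^d$, let $\gamma_{d,n}$ be the $\mathcal O(d)$-invariant Borel probability measure on it, and for $V\in\mathcal G(d,n)$ let $\pi_V\colon\mathbb R^d\to V$ be the orthogonal projection and $\pi_V\mu$ the push-forward of a measure $\mu$ under $\pi_V$. Write $\|\pi_V\mu\|_{L^p(V)}$ for the $L^p(\mathcal H^n|_V)$-norm of the density of $\pi_V\mu$ if $\pi_V\mu\ll\mathcal H^n|_V$, and $\|\pi_V\mu\|_{L^p(V)}=\infty$ otherwise. Let $B(x,r)$ denote closed balls. For $s<d$ put $p^*=p^*(d,n,s)=\frac{2d-n-s}{d-s}$, and put $p^*=\infty$ for $s\ge d$. (1) Let $\mu$ be a compactly supported Radon measure on $\mathbb R^d$ for which there is a constant $C>0$ such that $\mu(B(x,r))\le Cr^s$ for all $x\in\mathbb R^d$ and $r>0$. Then for every real $p$ with $1\le p<p^*$ the function $V\mapsto\|\pi_V\mu\|_{L^p(V)}^p$ is $\gamma_{d,n}$-measurable and $$\int_{\mathcal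 G(d,n)}\|\pi_V\mu\|_{L^p(V)}^p\,d\gamma_{d,n}(V)<\infty .$$ (2) For every real $p$ with $2\le p<p^*$ there is a constant $A>0$, depending only on $d,p,s$, such that for every $C_F>0$ and every Radon measure $\mu$ on $\mathbb R^d$ with $\operatorname{spt}\mu\subset B(0,1)$ and $\mu(B(x,r))\le C_Fr^s$ for all $x\in\mathbb R^d$ and $r>0$, $$\int_{\mathcal G(d,n)}\|\pi_V\mu\|_{L^p(V)}^p\,d\gamma_{d,n}(V)\le A\,C_F^{\,p}.$$ -/

import Mathlib

open MeasureTheory Measure Metric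
open scoped ENNReal NNReal

noncomputable section

/-- The space `ℝ^d` with its Euclidean norm. -/
abbrev Euc (d : ℕ) : Type := EuclideanSpace ℝ (Fin d)

/-- The orthogonal group `O(d)`: the linear maps `g` of `ℝ^d` with `g* g = g g* = 1`, with the
topology of the operator norm. -/
abbrev OrthGroup (d : ℕ) : Type := unitary (Euc d →L[ℝ] Euc d)

/-- The Grassmannian `G(d,n)` of `n`-dimensional linear subspaces of `ℝ^d`. -/
def Grass (d n : ℕ) : Type := {V : Submodule ℝ (Euc d) // Module.finrank ℝ V = n}

namespace Grass

variable {d n : ℕ}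

/-- The topology of the metric `d(V, W) = ‖π_V - π_W‖` (operator norm). -/
instance : TopologicalSpace (Grass d n) :=
  TopologicalSpace.induced (fun V : Grass d n => V.1.starProjection) inferInstance

instance : MeasurableSpace (Grass d n) := borel (Grass d n)

instance : BorelSpace (Grass d n) := ⟨rfl⟩

/-- The image `g V` of the plane `V` under `g ∈ O(d)`. -/
def rotate (g : OrthGroup d) (V : Grass d n) : Grass d n :=
  ⟨V.1.map (Unitary.linearIsometryEquiv g).toLinearEquiv.toLinearMap,
    (LinearEquiv.finrank_map_eq _ _).trans V.2⟩

/-- The plane spanned by the first `n` standard basis vectors of `ℝ^d`. -/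
def coordPlane (h : n ≤ d) : Grass d n :=
  ⟨Submodule.span ℝ (Set.range fun i : Fin n => EuclideanSpace.single (Fin.castLE h i) (1 : ℝ)), by
    have hli : LinearIndependent ℝ
        (fun i : Fin n => EuclideanSpace.single (Fin.castLE h i) (1 : ℝ)) := by
      have := (EuclideanSpace.orthonormal_single (𝕜 := ℝ) (ι := Fin d)).comp (Fin.castLE h)
        (Fin.castLE_injective h)
      exact this.linearIndependent
    rw [finrank_span_eq_card hli, Fintype.card_fin]⟩

end Grass

instance (d : ℕ) : ContinuousStar (Euc d →L[ℝ] Euc d) :=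
  ⟨(ContinuousLinearMap.adjoint (𝕜 := ℝ) (E := Euc d) (F := Euc d)).continuous⟩

instance (d : ℕ) : CompactSpace (OrthGroup d) := by
  refine isCompact_iff_compactSpace.1
    (Metric.isCompact_of_isClosed_isBounded isClosed_unitary ?_)
  refine (Metric.isBounded_closedBall (x := (0 : Euc d →L[ℝ] Euc d)) (r := 1)).subset ?_
  intro g hg
  rw [mem_closedBall_zero_iff]
  refine ContinuousLinearMap.opNorm_le_bound _ zero_le_one fun x => ?_
  rw [one_mul]
  exact ((Unitary.linearIsometryEquiv ⟨g, hg⟩).norm_map x).le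

/-- The Haar probability measure on `O(d)`. -/
def orthHaar (d : ℕ) : Measure (OrthGroup d) := haarMeasure ⊤

/-- The `O(d)`-invariant Borel probability measure `γ_{d,n}` on `G(d,n)`: the image of the Haar
probability measure of `O(d)` under the orbit map of an `n`-plane. -/
def grassMeasure {d n : ℕ} (h : n ≤ d) : Measure (Grass d n) :=
  (orthHaar d).map fun g => (Grass.coordPlane h).rotate g

/-- The orbit maps `g ↦ g V` are continuous, hence measurable. -/
theorem Grass.continuous_rotate {d n : ℕ} (V : Grass d n) :
    Continuous fun g : OrthGroup d => V.rotate g := by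
  rw [continuous_induced_rng]
  have key : ((fun W : Grass d n => W.1.starProjection) ∘ fun g : OrthGroup d => V.rotate g) =
      fun g : OrthGroup d => (g : Euc d →L[ℝ] Euc d) * V.1.starProjection *
        star (g : Euc d →L[ℝ] Euc d) := by
    funext g
    ext1 x
    exact Submodule.starProjection_map_apply (Unitary.linearIsometryEquiv g) V.1 x
  rw [key]
  exact (continuous_subtype_val.mul continuous_const).mul continuous_subtype_val.star

instance {d n : ℕ} (h : n ≤ d) : IsProbabilityMeasure (grassMeasure h) := by
  have : IsProbabilityMeasure (orthHaar d) := ⟨haarMeasure_self (K₀ := ⊤)⟩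
  exact isProbabilityMeasure_map (Grass.continuous_rotate _).measurable.aemeasurable

/-- The measure `γ_{d,n}` is `O(d)`-invariant. -/
theorem grassMeasure_map_rotate {d n : ℕ} (h : n ≤ d) (g : OrthGroup d) :
    (grassMeasure h).map (Grass.rotate g) = grassMeasure h := by
  have hg : Continuous (Grass.rotate g : Grass d n → Grass d n) := by
    rw [continuous_induced_rng]
    have key : ((fun W : Grass d n => W.1.starProjection) ∘ Grass.rotate g) =
        fun V : Grass d n => (g : Euc d →L[ℝ] Euc d) * V.1.starProjection *
          star (g : Euc d →L[ℝ] Euc d) := by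
      funext V
      ext1 x
      exact Submodule.starProjection_map_apply (Unitary.linearIsometryEquiv g) V.1 x
    rw [key]
    exact (continuous_const.mul continuous_induced_dom).mul continuous_const
  have hinv : (orthHaar d).map (fun k => g * k) = orthHaar d := by
    unfold orthHaar
    exact map_mul_left_eq_self _ g
  have hcomp : (Grass.rotate g ∘ fun k : OrthGroup d => (Grass.coordPlane h).rotate k) =
      (fun k : OrthGroup d => (Grass.coordPlane h).rotate k) ∘ fun k => g * k := by
    funext k
    refine Subtype.ext ?_
    simp only [Grass.rotate]
    exact (Submodule.map_comp _ _ _).symm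
  unfold grassMeasure
  rw [map_map hg.measurable (Grass.continuous_rotate _).measurable, hcomp,
    ← map_map (Grass.continuous_rotate _).measurable (measurable_const_mul g), hinv]

/-- The image `π_V μ` of the measure `μ` under the orthogonal projection `π_V : ℝ^d → V`. -/
def projMeasure {d : ℕ} (V : Submodule ℝ (Euc d)) (μ : Measure (Euc d)) : Measure V :=
  μ.map V.orthogonalProjectionOnto

open Classical in
/-- The norm `‖ν‖_{L^p(V)}` of a measure `ν` on a linear subspace `V`: the `L^p` norm, with respect
to the `n`-dimensional Lebesgue (equivalently Hausdorff) measure of the Euclidean space `V`,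
of the density of `ν` if `ν` is absolutely continuous, and `∞` otherwise. -/
def measureLpNorm {d : ℕ} {V : Submodule ℝ (Euc d)} (ν : Measure V) (p : ℝ) : ℝ≥0∞ :=
  if ν ≪ (volume : Measure V) then
    eLpNorm (ν.rnDeriv (volume : Measure V)) (ENNReal.ofReal p) (volume : Measure V)
  else ∞

/-- The `s`-dimensional Frostman condition `μ(B(x,r)) ≤ C r^s` for all closed balls. -/
def IsFrostman {d : ℕ} (μ : Measure (Euc d)) (s C : ℝ) : Prop :=
  ∀ (x : Euc d) (r : ℝ), 0 < r → μ (closedBall x r) ≤ ENNReal.ofReal (C * r ^ s)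

/-- The function `V ↦ ‖π_V μ‖_{L^p(V)}^p` on the Grassmannian `G(d,n)`. -/
def projLpPow {d : ℕ} (n : ℕ) (μ : Measure (Euc d)) (p : ℝ) (V : Grass d n) : ℝ≥0∞ :=
  measureLpNorm (projMeasure V.1 μ) p ^ p

end

/-! Let `s < d` and `κ = d - s`. Then `p < p*` says `κ(p-2)/2 < (s-n)/2`, and a number `σ` strictly
between is fixed. With `K_a` the Gaussian `gaussKer a`, two bounds on the projections are
interpolated.

Size, for every `V`: the Frostman condition gives `K_a * μ ≤ c C a^(-κ/2)`. Since `K_a` on `ℝ^d` is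
the product of the Gaussians of `V` and `Vᗮ`, integration over `Vᗮ` against `K_1` passes this bound
on to `π_V μ` (`gaussAvg_projMeasure_le`).

Smoothness, on average over `V`: the Fourier transform of `π_V μ` is the restriction of `μ̂` to `V`.
Integral geometry therefore turns the mean of `∫_V |ξ|^(2σ) |μ̂|²` into a multiple of `∫
|ξ|^(2σ+n-d) |μ̂|²`, a Riesz energy of order `n + 2σ < s`, which is `O(C²)`
(`exists_lintegral_sobolevNorm_le`).

Interpolation (`exists_lintegral_gaussAvg_rpow_le`): where `f = K_τ * ν` has size about `λ`, choose
a scale `t ~ λ^(-2/κ)` at which the size bound keeps the coarser averages below `λ/2` in total. An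
`N`-th order difference of `f` is then at least `λ/2`, while by Plancherel its squared `L²` norm is
at most `(πt)^σ` times the Sobolev norm. The sum of `λ^(p-2) t^σ` over dyadic `t` converges because
`κ(p-2)/2 < σ`.

Limit: averages over balls are dominated by Gaussian averages, and for `p > 1` the `liminf` of their
`L^p` integrals is exactly `‖π_V μ‖_p^p`, absolute continuity included
(`measureLpNorm_rpow_eq_liminf`). This gives measurability and, by Fatou, the estimate. The case `s
≥ d` reduces to an exponent slightly below `d`, and `p < 2` to `p = 2`, as `p* > 2`. -/

noncomputable section

open Real Set Filter
open scoped Topology InnerProductSpace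

set_option linter.unusedSectionVars false

/-! ### Gaussian kernels. -/

section Kernel

variable {E : Type*} [NormedAddCommGroup E] [InnerProductSpace ℝ E]

/-- The Gaussian `a^{-n/2} exp(-π |x|² / a)` on an `n`-dimensional Euclidean space. -/
def gaussKer (a : ℝ) (x : E) : ℝ :=
  a ^ (-(Module.finrank ℝ E : ℝ) / 2) * exp (-(π * ‖x‖ ^ 2 / a))

lemma gaussKer_pos {a : ℝ} (ha : 0 < a) (x : E) : 0 < gaussKer a x := by
  unfold gaussKer; positivity

lemma gaussKer_le {a : ℝ} (ha : 0 < a) (x : E) :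
    gaussKer a x ≤ a ^ (-(Module.finrank ℝ E : ℝ) / 2) := by
  unfold gaussKer
  refine mul_le_of_le_one_right (by positivity) ?_
  rw [exp_le_one_iff, neg_nonpos]
  positivity

lemma continuous_gaussKer (a : ℝ) : Continuous (gaussKer a : E → ℝ) := by
  unfold gaussKer; fun_prop

/-- Completing the square in `z` about the weighted mean of `x` and `y` leaves a factor that depends
on `x - y` only. -/
lemma gaussKer_mul_gaussKer {a b : ℝ} (ha : 0 < a) (hb : 0 < b) (x y z : E) :
    gaussKer a (z - x) * gaussKer b (z - y) = gaussKer (a + b) (x - y) *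
      gaussKer (a * b / (a + b)) (z - ((b / (a + b)) • x + (a / (a + b)) • y)) := by
  have hab : 0 < a + b := by positivity
  unfold gaussKer
  have e1 : ∀ p q r s : ℝ, p * exp q * (r * exp s) = p * r * exp (q + s) := by
    intro p q r s; rw [exp_add]; ring
  rw [e1, e1]
  have h1 : a ^ (-(Module.finrank ℝ E : ℝ) / 2) * b ^ (-(Module.finrank ℝ E : ℝ) / 2) =
      (a + b) ^ (-(Module.finrank ℝ E : ℝ) / 2) *
        (a * b / (a + b)) ^ (-(Module.finrank ℝ E : ℝ) / 2) := by
    rw [← mul_rpow ha.le hb.le, ← mul_rpow hab.le (by positivity)]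
    congr 1; field_simp
  rw [h1]
  congr 2
  have h2 : z - ((b / (a + b)) • x + (a / (a + b)) • y) =
      (b / (a + b)) • (z - x) + (a / (a + b)) • (z - y) := by
    have : z = (b / (a + b)) • z + (a / (a + b)) • z := by
      rw [← add_smul, ← add_div, add_comm b a, div_self hab.ne', one_smul]
    rw [smul_sub, smul_sub]
    nth_rewrite 1 [this]
    abel
  have h3 : x - y = (z - y) - (z - x) := by abel
  rw [h2, h3]
  generalize z - x = u
  generalize z - y = v
  rw [norm_add_sq_real, norm_sub_sq_real, norm_smul, norm_smul, real_inner_smul_left,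
    real_inner_smul_right, norm_of_nonneg (by positivity : 0 ≤ b / (a + b)),
    norm_of_nonneg (by positivity : 0 ≤ a / (a + b)), real_inner_comm u v]
  field_simp
  ring

variable [FiniteDimensional ℝ E] [MeasurableSpace E] [BorelSpace E]

lemma integrable_exp_neg_mul_sq_norm {b : ℝ} (hb : 0 < b) :
    Integrable fun x : E => exp (-(b * ‖x‖ ^ 2)) := by
  have h := (GaussianFourier.integrable_cexp_neg_mul_sq_norm_add (V := E) (b := (b : ℂ))
    (by simpa using hb) 0 0).norm
  refine h.congr (.of_forall fun x => ?_)
  simp only [Complex.norm_exp]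
  norm_cast
  simp

lemma integral_exp_neg_mul_sq_norm {a : ℝ} (ha : 0 < a) :
    ∫ x : E, exp (-(π * ‖x‖ ^ 2 / a)) = a ^ ((Module.finrank ℝ E : ℝ) / 2) := by
  have h := GaussianFourier.integral_rexp_neg_mul_sq_norm (V := E) (b := π / a) (by positivity)
  have e : π / (π / a) = a := by field_simp
  rw [e] at h
  rw [← h]
  refine integral_congr_ae (.of_forall fun x => ?_)
  simp only
  congr 1; ring

lemma integrable_gaussKer {a : ℝ} (ha : 0 < a) : Integrable (gaussKer a : E → ℝ) := by
  unfold gaussKer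
  refine Integrable.const_mul ?_ _
  refine (integrable_exp_neg_mul_sq_norm (E := E) (b := π / a) (by positivity)).congr
    (.of_forall fun x => ?_)
  simp only
  congr 1; ring

lemma integral_gaussKer {a : ℝ} (ha : 0 < a) : ∫ x : E, gaussKer a x = 1 := by
  unfold gaussKer
  rw [integral_const_mul, integral_exp_neg_mul_sq_norm ha, ← rpow_add ha]
  rw [neg_div, neg_add_cancel, rpow_zero]

/-- The Gaussian is the Fourier transform of a Gaussian. -/
lemma integral_exp_mul_cos {a : ℝ} (ha : 0 < a) (x : E) :
    ∫ ξ : E, exp (-(π * a * ‖ξ‖ ^ 2)) * cos (2 * π * ⟪x, ξ⟫_ℝ) = gaussKer a x := by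
  have hb : 0 < ((π * a : ℝ) : ℂ).re := by simpa using mul_pos pi_pos ha
  have h := GaussianFourier.integral_cexp_neg_mul_sq_norm_add hb (2 * π * Complex.I) x
  have hi := GaussianFourier.integrable_cexp_neg_mul_sq_norm_add hb (2 * π * Complex.I) x
  have h2 := congrArg Complex.re h
  rw [← RCLike.re_eq_complex_re, ← integral_re hi] at h2
  have e1 : ∀ ξ : E, RCLike.re (Complex.exp (-((π * a : ℝ) : ℂ) * (‖ξ‖ : ℂ) ^ 2 +
      2 * π * Complex.I * (⟪x, ξ⟫_ℝ : ℂ))) =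
      exp (-(π * a * ‖ξ‖ ^ 2)) * cos (2 * π * ⟪x, ξ⟫_ℝ) := by
    intro ξ
    rw [RCLike.re_eq_complex_re, Complex.exp_re]
    have : (-((π * a : ℝ) : ℂ) * (‖ξ‖ : ℂ) ^ 2 + 2 * π * Complex.I * (⟪x, ξ⟫_ℝ : ℂ)) =
      ((-(π * a * ‖ξ‖ ^ 2) : ℝ) : ℂ) + ((2 * π * ⟪x, ξ⟫_ℝ : ℝ) : ℂ) * Complex.I := by
      push_cast; ring
    rw [this, Complex.add_re, Complex.add_im, Complex.re_ofReal_mul, Complex.im_ofReal_mul,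
      Complex.ofReal_re, Complex.ofReal_im, Complex.I_re, Complex.I_im, mul_zero, add_zero,
      zero_add, mul_one]
  rw [integral_congr_ae (.of_forall e1)] at h2
  rw [h2]
  have e2 : ((π : ℂ) / ((π * a : ℝ) : ℂ)) ^ ((Module.finrank ℝ E : ℂ) / 2) *
      Complex.exp ((2 * π * Complex.I) ^ 2 * (‖x‖ : ℂ) ^ 2 / (4 * ((π * a : ℝ) : ℂ))) =
      ((gaussKer a x : ℝ) : ℂ) := by
    unfold gaussKer
    have hpi : (π : ℂ) ≠ 0 := by exact_mod_cast pi_pos.ne'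
    have ha' : (a : ℂ) ≠ 0 := by exact_mod_cast ha.ne'
    have e3 : (π : ℂ) / ((π * a : ℝ) : ℂ) = ((a⁻¹ : ℝ) : ℂ) := by
      push_cast; field_simp
    have e4 : (2 * π * Complex.I) ^ 2 * (‖x‖ : ℂ) ^ 2 / (4 * ((π * a : ℝ) : ℂ)) =
        ((-(π * ‖x‖ ^ 2 / a) : ℝ) : ℂ) := by
      push_cast
      rw [mul_pow, Complex.I_sq]; field_simp; ring
    have e5 : (Module.finrank ℝ E : ℂ) / 2 = (((Module.finrank ℝ E : ℝ) / 2 : ℝ) : ℂ) := by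
      push_cast; rfl
    rw [e3, e4, e5, ← Complex.ofReal_cpow (by positivity), ← Complex.ofReal_exp,
      ← Complex.ofReal_mul, inv_rpow ha.le, ← rpow_neg ha.le, neg_div]
  rw [e2, RCLike.re_eq_complex_re, Complex.ofReal_re]

/-- The semigroup property of the Gaussians. -/
lemma integral_gaussKer_mul {a b : ℝ} (ha : 0 < a) (hb : 0 < b) (x y : E) :
    ∫ z : E, gaussKer a (z - x) * gaussKer b (z - y) = gaussKer (a + b) (x - y) := by
  simp_rw [gaussKer_mul_gaussKer ha hb x y]
  rw [integral_const_mul, integral_sub_right_eq_self (fun z : E => gaussKer (a * b / (a + b)) z),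
    integral_gaussKer (by positivity), mul_one]

end Kernel

/-! ### Gaussian averages of a measure and Plancherel. -/

section Averages

variable {E : Type*} [NormedAddCommGroup E] [InnerProductSpace ℝ E] [MeasurableSpace E]

/-- The Gaussian average `∫ K_a(x - y) dν(y)` of a measure. -/
def gaussAvg (ν : Measure E) (a : ℝ) (x : E) : ℝ := ∫ y, gaussKer a (x - y) ∂ν

/-- The squared modulus `|ν̂(ξ)|²` of the Fourier transform of a measure. -/
def specPow (ν : Measure E) (ξ : E) : ℝ :=
  (∫ x, cos (2 * π * ⟪x, ξ⟫_ℝ) ∂ν) ^ 2 + (∫ x, sin (2 * π * ⟪x, ξ⟫_ℝ) ∂ν) ^ 2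

lemma specPow_nonneg (ν : Measure E) (ξ : E) : 0 ≤ specPow ν ξ := by
  unfold specPow; positivity

lemma gaussAvg_nonneg (ν : Measure E) {a : ℝ} (ha : 0 < a) (x : E) : 0 ≤ gaussAvg ν a x :=
  integral_nonneg fun _ => (gaussKer_pos ha _).le

variable [FiniteDimensional ℝ E] [BorelSpace E] (ν : Measure E) [IsFiniteMeasure ν]

lemma integrable_gaussKer_sub {a : ℝ} (ha : 0 < a) (x : E) :
    Integrable (fun y => gaussKer a (x - y)) ν := by
  refine Integrable.of_bound ((continuous_gaussKer a).comp
    (continuous_const.sub continuous_id)).aestronglyMeasurable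
    (a ^ (-(Module.finrank ℝ E : ℝ) / 2)) (.of_forall fun y => ?_)
  rw [norm_of_nonneg (gaussKer_pos ha _).le]
  exact gaussKer_le ha _

lemma ofReal_gaussAvg {a : ℝ} (ha : 0 < a) (x : E) :
    ENNReal.ofReal (gaussAvg ν a x) = ∫⁻ y, ENNReal.ofReal (gaussKer a (x - y)) ∂ν :=
  ofReal_integral_eq_lintegral_ofReal (integrable_gaussKer_sub ν ha x)
    (.of_forall fun _ => (gaussKer_pos ha _).le)

lemma stronglyMeasurable_gaussAvg (a : ℝ) : StronglyMeasurable (gaussAvg ν a) := by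
  unfold gaussAvg
  have h : StronglyMeasurable fun q : E × E => gaussKer a (q.1 - q.2) :=
    ((continuous_gaussKer a).comp (continuous_fst.sub continuous_snd)).stronglyMeasurable
  exact h.integral_prod_right

lemma integrable_gaussKer_mul_prod {a b : ℝ} (ha : 0 < a) (hb : 0 < b) :
    Integrable (fun q : E × (E × E) => gaussKer a (q.1 - q.2.1) * gaussKer b (q.1 - q.2.2))
      (volume.prod (ν.prod ν)) := by
  have hc : Continuous fun q : E × (E × E) =>
      gaussKer a (q.1 - q.2.1) * gaussKer b (q.1 - q.2.2) :=
    ((continuous_gaussKer a).comp (by fun_prop)).mul ((continuous_gaussKer b).comp (by fun_prop))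
  rw [integrable_prod_iff' hc.aestronglyMeasurable]
  constructor
  · refine .of_forall fun p => ?_
    simp_rw [gaussKer_mul_gaussKer ha hb]
    exact ((integrable_gaussKer (E := E) (by positivity)).comp_sub_right _).const_mul _
  · have e : ∀ p : E × E, ∫ z, ‖gaussKer a (z - p.1) * gaussKer b (z - p.2)‖ =
        gaussKer (a + b) (p.1 - p.2) := by
      intro p
      rw [← integral_gaussKer_mul ha hb]
      refine integral_congr_ae (.of_forall fun z => ?_)
      exact norm_of_nonneg (mul_nonneg (gaussKer_pos ha _).le (gaussKer_pos hb _).le)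
    simp_rw [e]
    refine Integrable.of_bound ((continuous_gaussKer _).comp
      (continuous_fst.sub continuous_snd)).aestronglyMeasurable
      ((a + b) ^ (-(Module.finrank ℝ E : ℝ) / 2)) (.of_forall fun y => ?_)
    rw [norm_of_nonneg (gaussKer_pos (by positivity) _).le]
    exact gaussKer_le (by positivity) _

lemma gaussAvg_mul_gaussAvg (a b : ℝ) (z : E) :
    gaussAvg ν a z * gaussAvg ν b z =
      ∫ p : E × E, gaussKer a (z - p.1) * gaussKer b (z - p.2) ∂(ν.prod ν) :=
  (integral_prod_mul _ _).symm

lemma integrable_gaussAvg_mul {a b : ℝ} (ha : 0 < a) (hb : 0 < b) :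
    Integrable fun z => gaussAvg ν a z * gaussAvg ν b z := by
  simp_rw [gaussAvg_mul_gaussAvg]
  exact (integrable_gaussKer_mul_prod ν ha hb).integral_prod_left

lemma integral_gaussAvg_mul {a b : ℝ} (ha : 0 < a) (hb : 0 < b) :
    ∫ z, gaussAvg ν a z * gaussAvg ν b z =
      ∫ p : E × E, gaussKer (a + b) (p.1 - p.2) ∂(ν.prod ν) := by
  simp_rw [gaussAvg_mul_gaussAvg]
  rw [integral_integral_swap (f := fun z (p : E × E) => gaussKer a (z - p.1) * gaussKer b (z - p.2))
    (integrable_gaussKer_mul_prod ν ha hb)]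
  simp_rw [integral_gaussKer_mul ha hb]

/-- Addition formula for the cosine; in this form Fubini applies to integrals of `|ν̂|²`. -/
lemma specPow_eq_integral (ξ : E) :
    specPow ν ξ = ∫ p : E × E, cos (2 * π * ⟪p.1 - p.2, ξ⟫_ℝ) ∂(ν.prod ν) := by
  have hcos : Continuous fun x : E => cos (2 * π * ⟪x, ξ⟫_ℝ) := by fun_prop
  have hsin : Continuous fun x : E => sin (2 * π * ⟪x, ξ⟫_ℝ) := by fun_prop
  have ic : Integrable (fun x : E => cos (2 * π * ⟪x, ξ⟫_ℝ)) ν :=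
    Integrable.of_bound hcos.aestronglyMeasurable 1 (.of_forall fun x => by
      simpa using abs_cos_le_one _)
  have isin : Integrable (fun x : E => sin (2 * π * ⟪x, ξ⟫_ℝ)) ν :=
    Integrable.of_bound hsin.aestronglyMeasurable 1 (.of_forall fun x => by
      simpa using abs_sin_le_one _)
  have e : ∀ p : E × E, cos (2 * π * ⟪p.1 - p.2, ξ⟫_ℝ) =
      cos (2 * π * ⟪p.1, ξ⟫_ℝ) * cos (2 * π * ⟪p.2, ξ⟫_ℝ) +
      sin (2 * π * ⟪p.1, ξ⟫_ℝ) * sin (2 * π * ⟪p.2, ξ⟫_ℝ) := by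
    intro p
    rw [inner_sub_left, mul_sub, cos_sub]
  simp_rw [e]
  rw [integral_add (ic.mul_prod ic) (isin.mul_prod isin), specPow,
    integral_prod_mul (fun x : E => cos (2 * π * ⟪x, ξ⟫_ℝ)) (fun x : E => cos (2 * π * ⟪x, ξ⟫_ℝ)),
    integral_prod_mul (fun x : E => sin (2 * π * ⟪x, ξ⟫_ℝ)) (fun x : E => sin (2 * π * ⟪x, ξ⟫_ℝ))]
  ring

lemma integrable_exp_mul_cos_prod {a : ℝ} (ha : 0 < a) :
    Integrable (fun q : E × (E × E) => exp (-(π * a * ‖q.1‖ ^ 2)) *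
      cos (2 * π * ⟪q.2.1 - q.2.2, q.1⟫_ℝ)) (volume.prod (ν.prod ν)) := by
  have h := (integrable_exp_neg_mul_sq_norm (E := E) (b := π * a) (by positivity)).mul_prod
    (integrable_const (1 : ℝ) (μ := ν.prod ν))
  refine h.mono' (by fun_prop) (.of_forall fun q => ?_)
  rw [norm_mul, norm_of_nonneg (exp_pos _).le]
  exact mul_le_mul_of_nonneg_left (by simpa using abs_cos_le_one _) (exp_pos _).le

lemma integrable_exp_mul_specPow {a : ℝ} (ha : 0 < a) :
    Integrable fun ξ : E => exp (-(π * a * ‖ξ‖ ^ 2)) * specPow ν ξ := by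
  simp_rw [specPow_eq_integral, ← integral_const_mul]
  exact (integrable_exp_mul_cos_prod ν ha).integral_prod_left

/-- Fubini and the Fourier transform of the Gaussian. The right side is also what
`integral_gaussAvg_mul` produces; matching the two gives Plancherel for Gaussian averages without
any `L²` theory. -/
lemma integral_exp_mul_specPow {a : ℝ} (ha : 0 < a) :
    ∫ ξ : E, exp (-(π * a * ‖ξ‖ ^ 2)) * specPow ν ξ =
      ∫ p : E × E, gaussKer a (p.1 - p.2) ∂(ν.prod ν) := by
  simp_rw [specPow_eq_integral, ← integral_const_mul]
  rw [integral_integral_swap (f := fun (ξ : E) (p : E × E) => exp (-(π * a * ‖ξ‖ ^ 2)) *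
      cos (2 * π * ⟪p.1 - p.2, ξ⟫_ℝ)) (integrable_exp_mul_cos_prod ν ha)]
  simp_rw [integral_exp_mul_cos ha]

lemma measurable_specPow : Measurable (specPow ν) := by
  have hcos : StronglyMeasurable fun q : E × E => cos (2 * π * ⟪q.2, q.1⟫_ℝ) := by
    refine Continuous.stronglyMeasurable ?_
    fun_prop
  have hsin : StronglyMeasurable fun q : E × E => sin (2 * π * ⟪q.2, q.1⟫_ℝ) := by
    refine Continuous.stronglyMeasurable ?_
    fun_prop
  exact ((hcos.integral_prod_right (ν := ν)).measurable.pow_const 2).add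
    ((hsin.integral_prod_right (ν := ν)).measurable.pow_const 2)

/-- The Plancherel identity for linear combinations of Gaussian averages. -/
lemma lintegral_sum_gaussAvg_sq {ι : Type*} (s : Finset ι) (c a : ι → ℝ) (ha : ∀ i, 0 < a i) :
    ∫⁻ z, ENNReal.ofReal ((∑ i ∈ s, c i * gaussAvg ν (a i) z) ^ 2) =
      ∫⁻ ξ : E, ENNReal.ofReal
        ((∑ i ∈ s, c i * exp (-(π * a i * ‖ξ‖ ^ 2))) ^ 2 * specPow ν ξ) := by
  have e1 : ∀ z, (∑ i ∈ s, c i * gaussAvg ν (a i) z) ^ 2 =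
      ∑ i ∈ s, ∑ j ∈ s, c i * c j * (gaussAvg ν (a i) z * gaussAvg ν (a j) z) := by
    intro z
    rw [sq, Finset.sum_mul_sum]
    exact Finset.sum_congr rfl fun i _ => Finset.sum_congr rfl fun j _ => by ring
  have e2 : ∀ ξ : E, (∑ i ∈ s, c i * exp (-(π * a i * ‖ξ‖ ^ 2))) ^ 2 * specPow ν ξ =
      ∑ i ∈ s, ∑ j ∈ s, c i * c j *
        (exp (-(π * (a i + a j) * ‖ξ‖ ^ 2)) * specPow ν ξ) := by
    intro ξ
    rw [sq, Finset.sum_mul_sum, Finset.sum_mul]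
    refine Finset.sum_congr rfl fun i _ => ?_
    rw [Finset.sum_mul]
    refine Finset.sum_congr rfl fun j _ => ?_
    have : -(π * (a i + a j) * ‖ξ‖ ^ 2) = -(π * a i * ‖ξ‖ ^ 2) + -(π * a j * ‖ξ‖ ^ 2) := by ring
    rw [this, exp_add]
    ring
  have i1 : ∀ i ∈ s, ∀ j ∈ s, Integrable fun z =>
      c i * c j * (gaussAvg ν (a i) z * gaussAvg ν (a j) z) := fun i _ j _ =>
    (integrable_gaussAvg_mul ν (ha i) (ha j)).const_mul _
  have i2 : ∀ i ∈ s, ∀ j ∈ s, Integrable fun ξ : E =>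
      c i * c j * (exp (-(π * (a i + a j) * ‖ξ‖ ^ 2)) * specPow ν ξ) := fun i _ j _ =>
    (integrable_exp_mul_specPow ν (add_pos (ha i) (ha j))).const_mul _
  -- Both sides are the quadratic form in `c` whose `(i, j)` entry is the double integral of `K_(a i
  -- + a j)`.
  rw [← ofReal_integral_eq_lintegral_ofReal, ← ofReal_integral_eq_lintegral_ofReal]
  · simp_rw [e1, e2]
    rw [integral_finsetSum _ fun i hi => integrable_finsetSum _ (i1 i hi),
      integral_finsetSum _ fun i hi => integrable_finsetSum _ (i2 i hi)]
    congr 1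
    refine Finset.sum_congr rfl fun i hi => ?_
    rw [integral_finsetSum _ (i1 i hi), integral_finsetSum _ (i2 i hi)]
    refine Finset.sum_congr rfl fun j hj => ?_
    rw [integral_const_mul, integral_const_mul, integral_gaussAvg_mul ν (ha i) (ha j),
      integral_exp_mul_specPow ν (add_pos (ha i) (ha j))]
  · simp_rw [e2]
    exact integrable_finsetSum _ fun i hi => integrable_finsetSum _ (i2 i hi)
  · exact .of_forall fun ξ => mul_nonneg (sq_nonneg _) (specPow_nonneg ν ξ)
  · simp_rw [e1]
    exact integrable_finsetSum _ fun i hi => integrable_finsetSum _ (i1 i hi)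
  · exact .of_forall fun z => sq_nonneg _

end Averages

/-- A pointwise form of an argument of Ledoux: if `x` is within `l q^k / 2` of `g k` for all `k`, then
`x ^ p` is controlled by a sum of multiples of the squares of the `g k`. -/
lemma ofReal_rpow_le_tsum {p x l q : ℝ} (hp : 1 ≤ p) (hx : 0 ≤ x) (hl : 0 < l) (hq : 1 < q)
    (g : ℕ → ℝ) (hg : ∀ k, x - g k ≤ l * q ^ k / 2) :
    ENNReal.ofReal (x ^ p) ≤ ENNReal.ofReal (l ^ (p - 1)) * ENNReal.ofReal x +
      ∑' k, ENNReal.ofReal (4 * (l * q ^ (k + 1)) ^ p / (l * q ^ k) ^ 2) *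
        ENNReal.ofReal (g k ^ 2) := by
  rcases le_or_gt x l with h | h
  · refine le_add_right ?_
    rw [← ENNReal.ofReal_mul (by positivity)]
    refine ENNReal.ofReal_le_ofReal ?_
    rcases hx.eq_or_lt with rfl | hx
    · rw [zero_rpow (by linarith)]; simp
    · calc x ^ p = x ^ (p - 1) * x := by
            rw [← rpow_add_one hx.ne', sub_add_cancel]
        _ ≤ l ^ (p - 1) * x := by gcongr
  -- The level `k` with `l q^k ≤ x < l q^(k+1)`: there `g k ≥ l q^k / 2`, so the `k`-th term alone
  -- dominates `x ^ p`.
  · obtain ⟨k, hk1, hk2⟩ := exists_nat_pow_near (x := x / l) (y := q)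
      (by rw [le_div_iff₀ hl]; linarith) hq
    rw [le_div_iff₀ hl] at hk1
    rw [div_lt_iff₀ hl] at hk2
    have hlk : 0 < l * q ^ k := by positivity
    refine le_add_left (le_trans ?_ (ENNReal.le_tsum k))
    rw [← ENNReal.ofReal_mul (by positivity)]
    refine ENNReal.ofReal_le_ofReal ?_
    have h1 : l * q ^ k / 2 ≤ g k := by have := hg k; linarith
    have h2 : (l * q ^ k) ^ 2 ≤ 4 * g k ^ 2 := by nlinarith
    have h3 : x ^ p ≤ (l * q ^ (k + 1)) ^ p := by
      gcongr
      linarith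
    calc x ^ p ≤ (l * q ^ (k + 1)) ^ p * 1 := by simpa using h3
      _ ≤ (l * q ^ (k + 1)) ^ p * (4 * g k ^ 2 / (l * q ^ k) ^ 2) := by
        gcongr
        rw [le_div_iff₀ (by positivity)]; simpa using h2
      _ = _ := by ring

/-! ### Interpolation between the size bound and the Sobolev norm. -/

section Averages

variable {E : Type*} [NormedAddCommGroup E] [InnerProductSpace ℝ E] [MeasurableSpace E]
  [FiniteDimensional ℝ E] [BorelSpace E] (ν : Measure E)

/-- The `N`-th order difference of the Gaussian averages. -/
def gaussDiff (N : ℕ) (τ t : ℝ) (z : E) : ℝ :=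
  ∑ j ∈ Finset.range (N + 1), (-1) ^ j * (N.choose j : ℝ) * gaussAvg ν (τ + j * t) z

/-- With `r = |ξ|²`, this is the Fourier multiplier of `gaussDiff`: it vanishes to order `N` in `r`
at `0`, which is what the difference is designed for. -/
lemma sum_choose_exp (N : ℕ) (τ t r : ℝ) :
    ∑ j ∈ Finset.range (N + 1), (-1) ^ j * (N.choose j : ℝ) * exp (-(π * (τ + j * t) * r)) =
      exp (-(π * τ * r)) * (1 - exp (-(π * t * r))) ^ N := by
  rw [sub_eq_neg_add, add_pow, Finset.mul_sum]
  refine Finset.sum_congr rfl fun j _ => ?_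
  have : -(π * (τ + j * t) * r) = -(π * τ * r) + j * -(π * t * r) := by ring
  rw [this, exp_add, exp_nat_mul, neg_pow (exp (-(π * t * r)))]
  simp only [one_pow, mul_one]
  ring

/-- The base is at most `min(1, u)`, so lowering the exponent from `m` to `σ` only increases the
power. -/
lemma one_sub_exp_neg_pow_le {u σ : ℝ} {m : ℕ} (hu : 0 ≤ u) (hσ : 0 ≤ σ) (hm : σ ≤ m) :
    (1 - exp (-u)) ^ m ≤ u ^ σ := by
  have h0 : 0 ≤ 1 - exp (-u) := by
    have : exp (-u) ≤ 1 := exp_le_one_iff.2 (by linarith)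
    linarith
  have h1 : 1 - exp (-u) ≤ 1 := by have := exp_pos (-u); linarith
  have h2 : 1 - exp (-u) ≤ u := by have := add_one_le_exp (-u); linarith
  rcases h0.eq_or_lt with h | h
  · rw [← h]
    rcases Nat.eq_zero_or_pos m with rfl | hm0
    · have : σ = 0 := le_antisymm (by simpa using hm) hσ
      simp [this]
    · rw [zero_pow hm0.ne']; positivity
  · rw [← rpow_natCast]
    calc (1 - exp (-u)) ^ (m : ℝ) ≤ (1 - exp (-u)) ^ σ :=
          rpow_le_rpow_of_exponent_ge h h1 hm
      _ ≤ u ^ σ := rpow_le_rpow h0 h2 hσ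

/-- The homogeneous Sobolev norm `∫ |ξ|^{2σ} |ν̂(ξ)|² dξ` of order `σ` of a measure. -/
def sobolevNorm (σ : ℝ) : ℝ≥0∞ := ∫⁻ ξ : E, ENNReal.ofReal (‖ξ‖ ^ (2 * σ) * specPow ν ξ)

variable [IsFiniteMeasure ν]

/-- By Plancherel the squared multiplier is at most `(1 - exp(-u))^(2N) ≤ u^σ` with `u = πt|ξ|²`;
hence the condition `σ ≤ 2N`. -/
lemma lintegral_gaussDiff_sq_le {N : ℕ} {τ t σ : ℝ} (hτ : 0 < τ) (ht : 0 < t) (hσ : 0 ≤ σ)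
    (hN : σ ≤ 2 * N) :
    ∫⁻ z, ENNReal.ofReal (gaussDiff ν N τ t z ^ 2) ≤
      ENNReal.ofReal ((π * t) ^ σ) * sobolevNorm ν σ := by
  unfold gaussDiff sobolevNorm
  rw [lintegral_sum_gaussAvg_sq ν _ (fun j => (-1) ^ j * (N.choose j : ℝ)) (fun j => τ + j * t)
    (fun j => by positivity), ← lintegral_const_mul' _ _ ENNReal.ofReal_ne_top]
  refine lintegral_mono fun ξ => ?_
  rw [← ENNReal.ofReal_mul (by positivity), sum_choose_exp, ← mul_assoc]
  refine ENNReal.ofReal_le_ofReal (mul_le_mul_of_nonneg_right ?_ (specPow_nonneg ν ξ))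
  have h1 : exp (-(π * τ * ‖ξ‖ ^ 2)) ^ 2 ≤ 1 :=
    pow_le_one₀ (exp_pos _).le (exp_le_one_iff.2 (by rw [neg_nonpos]; positivity))
  have h2 := one_sub_exp_neg_pow_le (u := π * t * ‖ξ‖ ^ 2) (m := 2 * N) (by positivity) hσ
    (by push_cast; exact hN)
  have h3 : (π * t * ‖ξ‖ ^ 2) ^ σ = (π * t) ^ σ * ‖ξ‖ ^ (2 * σ) := by
    rw [mul_rpow (by positivity) (by positivity), ← rpow_natCast ‖ξ‖ 2, ← rpow_mul (norm_nonneg _)]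
    norm_num
  rw [h3] at h2
  rw [mul_pow, ← pow_mul, mul_comm N 2]
  calc _ ≤ 1 * ((π * t) ^ σ * ‖ξ‖ ^ (2 * σ)) := by
        refine mul_le_mul h1 h2 ?_ zero_le_one
        rw [pow_mul]; exact pow_nonneg (sq_nonneg _) _
    _ = _ := one_mul _

lemma lintegral_gaussAvg {a : ℝ} (ha : 0 < a) :
    ∫⁻ z, ENNReal.ofReal (gaussAvg ν a z) = ν univ := by
  simp_rw [ofReal_gaussAvg ν ha]
  have hm : Measurable fun q : E × E => ENNReal.ofReal (gaussKer a (q.1 - q.2)) :=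
    (((continuous_gaussKer a).comp (continuous_fst.sub continuous_snd)).measurable).ennreal_ofReal
  rw [lintegral_lintegral_swap hm.aemeasurable]
  have : ∀ y : E, ∫⁻ x, ENNReal.ofReal (gaussKer a (x - y)) = 1 := by
    intro y
    rw [lintegral_sub_right_eq_self (fun x : E => ENNReal.ofReal (gaussKer a x)),
      ← ofReal_integral_eq_lintegral_ofReal (integrable_gaussKer ha)
        (.of_forall fun _ => (gaussKer_pos ha _).le), integral_gaussKer ha, ENNReal.ofReal_one]
  simp_rw [this]
  simp

/-- The term `j = 0` of the difference is the average itself. The others have parameter at least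
`t`, hence are at most `D t^(-κ/2)`; even `j` help by their sign, and the binomial coefficients sum
to at most `2^N`. -/
lemma gaussAvg_sub_gaussDiff_le {N : ℕ} {τ t D κ : ℝ} (hτ : 0 < τ) (ht : 0 < t) (hD : 0 ≤ D)
    (hκ : 0 < κ) (h1 : τ + N * t ≤ 1)
    (hsup : ∀ a, 0 < a → a ≤ 1 → ∀ z, gaussAvg ν a z ≤ D * a ^ (-κ / 2)) (z : E) :
    gaussAvg ν τ z - gaussDiff ν N τ t z ≤ 2 ^ N * (D * t ^ (-κ / 2)) := by
  unfold gaussDiff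
  rw [Finset.sum_range_succ']
  have hb : ∀ j ∈ Finset.range N, -((-1 : ℝ) ^ (j + 1) * (N.choose (j + 1) : ℝ) *
      gaussAvg ν (τ + (j + 1 : ℕ) * t) z) ≤ (N.choose (j + 1) : ℝ) * (D * t ^ (-κ / 2)) := by
    intro j hj
    have hj' : ((j + 1 : ℕ) : ℝ) ≤ N := by exact_mod_cast Finset.mem_range.1 hj
    have hpos : 0 < τ + (j + 1 : ℕ) * t := by positivity
    have hle : t ≤ τ + (j + 1 : ℕ) * t := by push_cast; nlinarith
    have hg := hsup _ hpos (le_trans (by gcongr) h1) z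
    have hg0 := gaussAvg_nonneg ν hpos z
    have hg2 : gaussAvg ν (τ + (j + 1 : ℕ) * t) z ≤ D * t ^ (-κ / 2) := hg.trans (by
      refine mul_le_mul_of_nonneg_left ?_ hD
      exact rpow_le_rpow_of_nonpos ht hle (by linarith))
    have hc : (0 : ℝ) ≤ N.choose (j + 1) := by positivity
    rcases neg_one_pow_eq_or ℝ (j + 1) with h | h
    · rw [h]
      have : 0 ≤ (N.choose (j + 1) : ℝ) * (D * t ^ (-κ / 2)) := by positivity
      have := mul_nonneg hc hg0
      linarith
    · rw [h]
      have := mul_le_mul_of_nonneg_left hg2 hc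
      linarith
  have hs := Finset.sum_le_sum hb
  rw [Finset.sum_neg_distrib, ← Finset.sum_mul] at hs
  have hch : ∑ j ∈ Finset.range N, (N.choose (j + 1) : ℝ) ≤ 2 ^ N := by
    have h := Nat.sum_range_choose N
    rw [Finset.sum_range_succ'] at h
    have : ∑ j ∈ Finset.range N, N.choose (j + 1) ≤ 2 ^ N := by omega
    exact_mod_cast this
  have hs2 := mul_le_mul_of_nonneg_right hch (by positivity : 0 ≤ D * t ^ (-κ / 2))
  simp only [pow_zero, Nat.choose_zero_right, Nat.cast_one, one_mul, Nat.cast_zero, zero_mul,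
    add_zero]
  linarith

/-- An interpolation inequality: a bound for Gaussian averages in a negative Hölder class and a
bound for the Sobolev norm give bounds for the `L^p` norms. -/
lemma exists_lintegral_gaussAvg_rpow_le (N : ℕ) {p κ σ : ℝ} (hp : 1 ≤ p) (hκ : 0 < κ)
    (hσ0 : 0 ≤ σ) (hσ : κ * (p - 2) / 2 < σ) (hN : σ ≤ 2 * N) (hN0 : 0 < N) :
    ∃ A : ℝ, 0 < A ∧ ∀ {E : Type} [NormedAddCommGroup E] [InnerProductSpace ℝ E]
      [MeasurableSpace E] [FiniteDimensional ℝ E] [BorelSpace E] (ν : Measure E)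
      [IsFiniteMeasure ν] (D : ℝ), 0 < D →
      (∀ a, 0 < a → a ≤ 1 → ∀ z, gaussAvg ν a z ≤ D * a ^ (-κ / 2)) →
      ∀ τ, 0 < τ → τ ≤ 1 / 2 →
      ∫⁻ z, ENNReal.ofReal (gaussAvg ν τ z ^ p) ≤
        ENNReal.ofReal (A * D ^ (p - 1)) * ν univ +
        ENNReal.ofReal (A * D ^ (p - 2)) * sobolevNorm ν σ := by
  -- With `τ ≤ 1/2` this keeps all parameters `τ + j t` in `(0, 1]`, where the size bound holds.
  set t₀ : ℝ := 1 / (2 * N) with ht₀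
  have hN' : (0 : ℝ) < N := by exact_mod_cast hN0
  have ht₀pos : 0 < t₀ := by positivity
  -- The factor by which `t^(-κ/2)` grows when `t` is halved: levels `M D q^k` go with scales `t₀ /
  -- 2^k`.
  set q : ℝ := 2 ^ (κ / 2) with hq
  have hq1 : 1 < q := one_lt_rpow (by norm_num) (by positivity)
  -- Makes half of the `k`-th level equal to the bound `2^N D t_k^(-κ/2)` of
  -- `gaussAvg_sub_gaussDiff_le`.
  set M : ℝ := 2 ^ (N + 1) * t₀ ^ (-κ / 2) with hM
  have hMpos : 0 < M := by positivity
  -- The ratio of the series over the levels; `r < 1` is the hypothesis `κ(p-2)/2 < σ`.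
  set r : ℝ := q ^ (p - 2) * 2 ^ (-σ) with hr
  have hrpos : 0 < r := by positivity
  have hr1 : r < 1 := by
    rw [hr, hq, ← rpow_mul (by norm_num), ← rpow_add (by norm_num)]
    exact rpow_lt_one_of_one_lt_of_neg (by norm_num) (by linarith)
  set A₂ : ℝ := 4 * q ^ p * M ^ (p - 2) * (π * t₀) ^ σ * (1 - r)⁻¹ with hA₂
  have h1r : 0 < 1 - r := by linarith
  refine ⟨M ^ (p - 1) + A₂, by positivity, ?_⟩
  intro E _ _ _ _ _ ν _ D hD hsup τ hτ hτ1
  set t : ℕ → ℝ := fun k => t₀ * (1 / 2) ^ k with ht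
  have htpos : ∀ k, 0 < t k := fun k => by positivity
  have htk : ∀ k, t k ≤ t₀ := fun k =>
    mul_le_of_le_one_right ht₀pos.le (pow_le_one₀ (by norm_num) (by norm_num))
  have hscale : ∀ k, M * D * q ^ k / 2 = 2 ^ N * (D * t k ^ (-κ / 2)) := by
    intro k
    have : t k ^ (-κ / 2) = t₀ ^ (-κ / 2) * q ^ k := by
      rw [ht, mul_rpow ht₀pos.le (by positivity), hq, ← rpow_natCast (1 / 2 : ℝ) k,
        ← rpow_natCast _ k, ← rpow_mul (by norm_num), ← rpow_mul (by norm_num), one_div,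
        inv_rpow (by norm_num), ← rpow_neg (by norm_num)]
      congr 2; ring
    rw [this, hM, pow_succ]; ring
  have key : ∀ z, ENNReal.ofReal (gaussAvg ν τ z ^ p) ≤
      ENNReal.ofReal ((M * D) ^ (p - 1)) * ENNReal.ofReal (gaussAvg ν τ z) +
      ∑' k, ENNReal.ofReal (4 * (M * D * q ^ (k + 1)) ^ p / (M * D * q ^ k) ^ 2) *
        ENNReal.ofReal (gaussDiff ν N τ (t k) z ^ 2) := by
    intro z
    refine ofReal_rpow_le_tsum hp (gaussAvg_nonneg ν hτ z) (by positivity) hq1 _ fun k => ?_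
    rw [hscale]
    refine gaussAvg_sub_gaussDiff_le ν hτ (htpos k) hD.le hκ ?_ hsup z
    have : N * t k ≤ N * t₀ := by gcongr; exact htk k
    have : N * t₀ = 1 / 2 := by rw [ht₀]; field_simp
    linarith
  have hmeas : ∀ k, Measurable fun z => ENNReal.ofReal (gaussDiff ν N τ (t k) z ^ 2) := by
    intro k
    refine Measurable.ennreal_ofReal (Measurable.pow_const ?_ 2)
    unfold gaussDiff
    exact Finset.measurable_fun_sum _ fun j _ =>
      (stronglyMeasurable_gaussAvg ν _).measurable.const_mul _
  have hm0 : Measurable fun z => ENNReal.ofReal (gaussAvg ν τ z) :=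
    (stronglyMeasurable_gaussAvg ν _).measurable.ennreal_ofReal
  have hcoef : ∀ k, 4 * (M * D * q ^ (k + 1)) ^ p / (M * D * q ^ k) ^ 2 * (π * t k) ^ σ =
      A₂ * (1 - r) * D ^ (p - 2) * r ^ k := by
    intro k
    have hx : 0 < M * D * q ^ k := by positivity
    have e1 : (M * D * q ^ (k + 1)) ^ p / (M * D * q ^ k) ^ 2 =
        q ^ p * (M * D * q ^ k) ^ (p - 2) := by
      rw [pow_succ, ← mul_assoc, mul_rpow hx.le (by positivity), rpow_sub hx, rpow_two]
      ring
    have e2 : (M * D * q ^ k) ^ (p - 2) = M ^ (p - 2) * D ^ (p - 2) * (q ^ (p - 2)) ^ k := by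
      rw [mul_rpow (by positivity) (by positivity), mul_rpow hMpos.le hD.le,
        ← rpow_pow_comm (x := q) (by positivity)]
    have e3 : (π * t k) ^ σ = (π * t₀) ^ σ * (2 ^ (-σ)) ^ k := by
      rw [ht, ← mul_assoc, mul_rpow (by positivity) (by positivity), ← rpow_natCast (1 / 2 : ℝ) k,
        ← rpow_natCast _ k, ← rpow_mul (by norm_num), ← rpow_mul (by norm_num), one_div,
        inv_rpow (by norm_num), ← rpow_neg (by norm_num)]
      congr 2; ring
    have e4 : A₂ * (1 - r) = 4 * q ^ p * M ^ (p - 2) * (π * t₀) ^ σ := by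
      rw [hA₂, mul_assoc, inv_mul_cancel₀ h1r.ne', mul_one]
    rw [mul_div_assoc, e1, e2, e3, e4, hr, mul_pow]
    ring
  calc ∫⁻ z, ENNReal.ofReal (gaussAvg ν τ z ^ p)
      ≤ ENNReal.ofReal ((M * D) ^ (p - 1)) * ν univ +
        ∑' k, ENNReal.ofReal (4 * (M * D * q ^ (k + 1)) ^ p / (M * D * q ^ k) ^ 2) *
          ∫⁻ z, ENNReal.ofReal (gaussDiff ν N τ (t k) z ^ 2) := by
        refine (lintegral_mono key).trans_eq ?_
        rw [lintegral_add_left (hm0.const_mul _), lintegral_const_mul _ hm0, lintegral_gaussAvg ν hτ,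
          lintegral_tsum fun k => ((hmeas k).const_mul _).aemeasurable]
        simp_rw [lintegral_const_mul _ (hmeas _)]
    _ ≤ ENNReal.ofReal ((M * D) ^ (p - 1)) * ν univ +
        ∑' k, ENNReal.ofReal (A₂ * (1 - r) * D ^ (p - 2) * r ^ k) * sobolevNorm ν σ := by
        refine add_le_add le_rfl (ENNReal.tsum_le_tsum fun k => ?_)
        refine (mul_le_mul_right (lintegral_gaussDiff_sq_le ν hτ (htpos k) hσ0 hN) _).trans_eq ?_
        rw [← mul_assoc, ← ENNReal.ofReal_mul (by positivity), hcoef]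
    _ = ENNReal.ofReal ((M * D) ^ (p - 1)) * ν univ +
        ENNReal.ofReal (A₂ * D ^ (p - 2)) * sobolevNorm ν σ := by
        rw [ENNReal.tsum_mul_right, ← ENNReal.ofReal_tsum_of_nonneg (fun k => by positivity)
          ((summable_geometric_of_lt_one hrpos.le hr1).mul_left _), tsum_mul_left,
          tsum_geometric_of_lt_one hrpos.le hr1]
        congr 3
        field_simp
    _ ≤ _ := by
        rw [mul_rpow hMpos.le hD.le]
        have : 0 < A₂ := by positivity
        have : 0 < M ^ (p - 1) := by positivity
        gcongr <;> linarith

end Averages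

/-! ### The size bound for Frostman measures. -/

lemma summable_exp_neg_mul_rpow (s : ℝ) :
    Summable fun k : ℕ => exp (-(k : ℝ)) * ((k : ℝ) + 1) ^ s := by
  obtain ⟨M, hM⟩ := exists_nat_ge s
  have h := ((summable_nat_add_iff 1).2
    (Real.summable_pow_mul_exp_neg_nat_mul M one_pos)).mul_left (exp 1)
  refine Summable.of_nonneg_of_le (fun k => by positivity) (fun k => ?_) h
  have h1 : ((k : ℝ) + 1) ^ s ≤ ((k : ℝ) + 1) ^ M := by
    rw [← rpow_natCast]
    exact rpow_le_rpow_of_exponent_le (by linarith [(Nat.cast_nonneg k : (0 : ℝ) ≤ k)]) hM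
  have h2 : exp (-(k : ℝ)) = exp 1 * exp (-1 * ((k + 1 : ℕ) : ℝ)) := by
    rw [← exp_add]; congr 1; push_cast; ring
  rw [h2]
  push_cast
  calc _ ≤ exp 1 * exp (-1 * ((k : ℝ) + 1)) * ((k : ℝ) + 1) ^ M := by gcongr
    _ = _ := by ring

/-- Gaussian averages of Frostman measures. -/
lemma exists_gaussAvg_le_of_isFrostman (d : ℕ) (s : ℝ) :
    ∃ c : ℝ, 0 < c ∧ ∀ (μ : Measure (Euc d)) [IsFiniteMeasure μ] (C : ℝ), 0 ≤ C →
      IsFrostman μ s C → ∀ a, 0 < a → ∀ x, gaussAvg μ a x ≤ c * C * a ^ ((s - d) / 2) := by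
  have hsum := summable_exp_neg_mul_rpow s
  refine ⟨(∑' k : ℕ, exp (-(k : ℝ)) * ((k : ℝ) + 1) ^ s) + 1, ?_, ?_⟩
  · have : 0 ≤ ∑' k : ℕ, exp (-(k : ℝ)) * ((k : ℝ) + 1) ^ s :=
      tsum_nonneg fun k => by positivity
    linarith
  intro μ _ C hC hF a ha x
  set b : ℝ := √a with hb
  have hbpos : 0 < b := sqrt_pos.2 ha
  have hb2 : b ^ 2 = a := sq_sqrt ha.le
  -- On the shell `k b ≤ |x - y| ≤ (k+1) b` with `b = √a` the exponential is at most `exp(-π k²) ≤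
  -- exp(-k)`, and the shell lies in the ball of radius `(k+1) b`.
  have hpt : ∀ y, ENNReal.ofReal (gaussKer a (x - y)) ≤
      ∑' k : ℕ, (closedBall x (((k : ℝ) + 1) * b)).indicator
        (fun _ => ENNReal.ofReal (a ^ (-(d : ℝ) / 2) * exp (-(k : ℝ)))) y := by
    intro y
    set k := ⌊‖x - y‖ / b⌋₊ with hk
    have hk1 : (k : ℝ) * b ≤ ‖x - y‖ := by
      rw [← le_div_iff₀ hbpos]; exact Nat.floor_le (by positivity)
    have hk2 : ‖x - y‖ ≤ ((k : ℝ) + 1) * b := by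
      rw [← div_le_iff₀ hbpos]; exact (Nat.lt_floor_add_one _).le
    refine le_trans ?_ (ENNReal.le_tsum k)
    rw [indicator_of_mem (by rwa [mem_closedBall, dist_comm, dist_eq_norm])]
    refine ENNReal.ofReal_le_ofReal ?_
    unfold gaussKer
    rw [finrank_euclideanSpace, Fintype.card_fin]
    gcongr
    rw [le_div_iff₀ ha, ← hb2]
    have h3 : ((k : ℝ) * b) ^ 2 ≤ ‖x - y‖ ^ 2 := by gcongr
    have h4 : (k : ℝ) ≤ k ^ 2 := by
      exact_mod_cast Nat.le_self_pow (by norm_num) k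
    have h5 : 1 ≤ π := by linarith [pi_gt_three]
    calc (k : ℝ) * b ^ 2 ≤ k ^ 2 * b ^ 2 := by gcongr
      _ = 1 * (k * b) ^ 2 := by ring
      _ ≤ π * ‖x - y‖ ^ 2 := by gcongr
  have hle : ENNReal.ofReal (gaussAvg μ a x) ≤ ENNReal.ofReal
      ((∑' k : ℕ, exp (-(k : ℝ)) * ((k : ℝ) + 1) ^ s) * (C * a ^ ((s - d) / 2))) := by
    rw [ofReal_gaussAvg μ ha]
    calc _ ≤ ∫⁻ y, ∑' k : ℕ, (closedBall x (((k : ℝ) + 1) * b)).indicator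
          (fun _ => ENNReal.ofReal (a ^ (-(d : ℝ) / 2) * exp (-(k : ℝ)))) y ∂μ :=
          lintegral_mono hpt
      _ = ∑' k : ℕ, ENNReal.ofReal (a ^ (-(d : ℝ) / 2) * exp (-(k : ℝ))) *
          μ (closedBall x (((k : ℝ) + 1) * b)) := by
          rw [lintegral_tsum fun k =>
            (measurable_const.indicator measurableSet_closedBall).aemeasurable]
          simp_rw [lintegral_indicator_const measurableSet_closedBall]
      _ ≤ ∑' k : ℕ, ENNReal.ofReal
          ((exp (-(k : ℝ)) * ((k : ℝ) + 1) ^ s) * (C * a ^ ((s - d) / 2))) := by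
          refine ENNReal.tsum_le_tsum fun k => ?_
          refine (mul_le_mul_right (hF x _ (by positivity)) _).trans_eq ?_
          rw [← ENNReal.ofReal_mul (by positivity)]
          congr 1
          have e1 : b ^ s = a ^ (s / 2) := by
            rw [hb, sqrt_eq_rpow, ← rpow_mul ha.le]; congr 1; ring
          have e2 : a ^ ((s - d) / 2) = a ^ (-(d : ℝ) / 2) * a ^ (s / 2) := by
            rw [← rpow_add ha]; congr 1; ring
          rw [mul_rpow (by positivity) hbpos.le, e1, e2]
          ring
      _ = _ := by
          rw [← tsum_mul_right, ENNReal.ofReal_tsum_of_nonneg (fun k => by positivity)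
            (hsum.mul_right _)]
  have h0 : 0 ≤ ∑' k : ℕ, exp (-(k : ℝ)) * ((k : ℝ) + 1) ^ s :=
    tsum_nonneg fun k => by positivity
  rw [ENNReal.ofReal_le_ofReal_iff (by positivity)] at hle
  refine hle.trans ?_
  rw [mul_assoc]
  gcongr
  linarith

/-! ### Transfer of the size bound to projections. -/

section Projection

variable {d : ℕ} (V : Submodule ℝ (Euc d))

lemma norm_add_sub_sq (x : V) (w : Vᗮ) (y : Euc d) :
    ‖(x : Euc d) + w - y‖ ^ 2 = ‖x - V.orthogonalProjectionOnto y‖ ^ 2 +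
      ‖w - Vᗮ.orthogonalProjectionOnto y‖ ^ 2 := by
  have e : (x : Euc d) + w - y = ((x - V.orthogonalProjectionOnto y : V) : Euc d) +
      ((w - Vᗮ.orthogonalProjectionOnto y : Vᗮ) : Euc d) := by
    have h : y = (V.orthogonalProjectionOnto y : Euc d) + (Vᗮ.orthogonalProjectionOnto y) := by
      simp
    push_cast
    nth_rewrite 1 [h]
    abel
  rw [e, sq, norm_add_sq_eq_norm_sq_add_norm_sq_real, Submodule.coe_norm, Submodule.coe_norm, sq,
    sq]
  exact Submodule.inner_right_of_mem_orthogonal (x - V.orthogonalProjectionOnto y).2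
    (w - Vᗮ.orthogonalProjectionOnto y).2

lemma gaussKer_add_sub (a : ℝ) (ha : 0 < a) (x : V) (w : Vᗮ) (y : Euc d) :
    gaussKer a ((x : Euc d) + w - y) = gaussKer a (x - V.orthogonalProjectionOnto y) *
      gaussKer a (w - Vᗮ.orthogonalProjectionOnto y) := by
  unfold gaussKer
  have h := V.finrank_add_finrank_orthogonal
  rw [norm_add_sub_sq, ← h]
  have e1 : -((Module.finrank ℝ V + Module.finrank ℝ Vᗮ : ℕ) : ℝ) / 2 =
      -(Module.finrank ℝ V : ℝ) / 2 + -(Module.finrank ℝ Vᗮ : ℝ) / 2 := by push_cast; ring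
  rw [e1, rpow_add ha, mul_add, add_div, neg_add, exp_add]
  ring

/-- The kernel on `ℝ^d` factors over `V` and `Vᗮ`, and by the semigroup property integration of the
second factor against `K_1` leaves `K_(a+1)` at the component of `y` in `Vᗮ`. For `|y| ≤ R` and `a ≤
1` this is at least `2^(-d/2) exp(-πR²)`. -/
lemma gaussKer_le_mul_lintegral {a R : ℝ} (ha : 0 < a) (ha1 : a ≤ 1) (x : V) {y : Euc d}
    (hy : ‖y‖ ≤ R) :
    ENNReal.ofReal (gaussKer a (x - V.orthogonalProjectionOnto y)) ≤
      ENNReal.ofReal (2 ^ ((d : ℝ) / 2) * exp (π * R ^ 2)) *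
      ∫⁻ w : Vᗮ, ENNReal.ofReal (gaussKer 1 w) * ENNReal.ofReal (gaussKer a ((x : Euc d) + w - y)) := by
  set y' := Vᗮ.orthogonalProjectionOnto y with hy'
  have hy'R : ‖y'‖ ≤ R := (Submodule.norm_orthogonalProjectionOnto_apply_le _ _).trans hy
  have e1 : ∀ w : Vᗮ, ENNReal.ofReal (gaussKer 1 w) *
      ENNReal.ofReal (gaussKer a ((x : Euc d) + w - y)) =
      ENNReal.ofReal (gaussKer a (x - V.orthogonalProjectionOnto y)) *
        ENNReal.ofReal (gaussKer a (w - y') * gaussKer 1 (w - 0)) := by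
    intro w
    rw [gaussKer_add_sub V a ha, ← ENNReal.ofReal_mul (gaussKer_pos one_pos _).le,
      ← ENNReal.ofReal_mul (gaussKer_pos ha _).le, sub_zero]
    congr 1; ring
  have hi : Integrable fun w : Vᗮ => gaussKer a (w - y') * gaussKer 1 (w - 0) := by
    simp_rw [gaussKer_mul_gaussKer ha one_pos]
    exact ((integrable_gaussKer (E := Vᗮ) (by positivity)).comp_sub_right _).const_mul _
  simp_rw [e1]
  rw [lintegral_const_mul' _ _ ENNReal.ofReal_ne_top, ← ofReal_integral_eq_lintegral_ofReal hi
    (.of_forall fun w => mul_nonneg (gaussKer_pos ha _).le (gaussKer_pos one_pos _).le),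
    integral_gaussKer_mul ha one_pos, sub_zero,
    ← ENNReal.ofReal_mul (gaussKer_pos ha _).le, ← ENNReal.ofReal_mul (by positivity)]
  refine ENNReal.ofReal_le_ofReal ?_
  have hk : 1 ≤ 2 ^ ((d : ℝ) / 2) * exp (π * R ^ 2) * gaussKer (a + 1) y' := by
    unfold gaussKer
    have hf : Module.finrank ℝ Vᗮ ≤ d := by
      have := Vᗮ.finrank_le
      rwa [finrank_euclideanSpace, Fintype.card_fin] at this
    have hf' : (Module.finrank ℝ Vᗮ : ℝ) ≤ d := by exact_mod_cast hf
    have h1 : (2 : ℝ) ^ (-(d : ℝ) / 2) ≤ (a + 1) ^ (-(Module.finrank ℝ Vᗮ : ℝ) / 2) := by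
      calc (2 : ℝ) ^ (-(d : ℝ) / 2) ≤ 2 ^ (-(Module.finrank ℝ Vᗮ : ℝ) / 2) :=
            rpow_le_rpow_of_exponent_le (by norm_num) (by linarith)
        _ ≤ _ := rpow_le_rpow_of_nonpos (by positivity) (by linarith)
            (by have : (0 : ℝ) ≤ Module.finrank ℝ Vᗮ := by positivity
                linarith)
    have h2 : exp (-(π * R ^ 2)) ≤ exp (-(π * ‖y'‖ ^ 2 / (a + 1))) := by
      gcongr
      calc π * ‖y'‖ ^ 2 / (a + 1) ≤ π * ‖y'‖ ^ 2 := div_le_self (by positivity) (by linarith)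
        _ ≤ _ := by gcongr
    calc (1 : ℝ) = 2 ^ ((d : ℝ) / 2) * exp (π * R ^ 2) *
          (2 ^ (-(d : ℝ) / 2) * exp (-(π * R ^ 2))) := by
          rw [exp_neg, neg_div, rpow_neg (by norm_num)]
          field_simp
      _ ≤ _ := by gcongr
  calc gaussKer a (x - V.orthogonalProjectionOnto y)
      = gaussKer a (x - V.orthogonalProjectionOnto y) * 1 := (mul_one _).symm
    _ ≤ gaussKer a (x - V.orthogonalProjectionOnto y) *
        (2 ^ ((d : ℝ) / 2) * exp (π * R ^ 2) * gaussKer (a + 1) y') :=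
        mul_le_mul_of_nonneg_left hk (gaussKer_pos ha _).le
    _ = _ := by ring

instance (μ : Measure (Euc d)) [IsFiniteMeasure μ] : IsFiniteMeasure (projMeasure V μ) := by
  unfold projMeasure; infer_instance

/-- Gaussian averages of the projections of a measure are bounded by those of the measure. -/
lemma gaussAvg_projMeasure_le (μ : Measure (Euc d)) [IsFiniteMeasure μ] {a R B : ℝ} (ha : 0 < a)
    (ha1 : a ≤ 1) (hR : μ (closedBall 0 R)ᶜ = 0) (hB : ∀ z, gaussAvg μ a z ≤ B) (x : V) :
    gaussAvg (projMeasure V μ) a x ≤ 2 ^ ((d : ℝ) / 2) * exp (π * R ^ 2) * B := by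
  have hB0 : 0 ≤ B := (gaussAvg_nonneg μ ha 0).trans (hB 0)
  have hmk : Measurable fun y : V => ENNReal.ofReal (gaussKer a (x - y)) :=
    ((continuous_gaussKer a).comp (by fun_prop)).measurable.ennreal_ofReal
  rw [← ENNReal.ofReal_le_ofReal_iff (by positivity), ofReal_gaussAvg _ ha, projMeasure,
    lintegral_map hmk V.orthogonalProjectionOnto.continuous.measurable]
  have hae : ∀ᵐ y ∂μ, ‖y‖ ≤ R := by
    rw [ae_iff]
    convert hR using 2
    ext y; simp
  have hm : Measurable fun q : Euc d × Vᗮ => ENNReal.ofReal (gaussKer 1 q.2) *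
      ENNReal.ofReal (gaussKer a ((x : Euc d) + q.2 - q.1)) := by
    have h1 : Continuous fun q : Euc d × Vᗮ => gaussKer 1 q.2 :=
      (continuous_gaussKer 1).comp continuous_snd
    have h2 : Continuous fun q : Euc d × Vᗮ => gaussKer a ((x : Euc d) + q.2 - q.1) :=
      (continuous_gaussKer a).comp (by fun_prop)
    exact h1.measurable.ennreal_ofReal.mul h2.measurable.ennreal_ofReal
  calc _ ≤ ∫⁻ y, ENNReal.ofReal (2 ^ ((d : ℝ) / 2) * exp (π * R ^ 2)) *
        (∫⁻ w : Vᗮ, ENNReal.ofReal (gaussKer 1 w) *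
          ENNReal.ofReal (gaussKer a ((x : Euc d) + w - y))) ∂μ := by
        refine lintegral_mono_ae ?_
        filter_upwards [hae] with y hy using gaussKer_le_mul_lintegral V ha ha1 x hy
    _ = ENNReal.ofReal (2 ^ ((d : ℝ) / 2) * exp (π * R ^ 2)) *
        ∫⁻ w : Vᗮ, ENNReal.ofReal (gaussKer 1 w) * ENNReal.ofReal (gaussAvg μ a (x + w)) := by
        rw [lintegral_const_mul' _ _ ENNReal.ofReal_ne_top,
          lintegral_lintegral_swap hm.aemeasurable]
        simp_rw [ofReal_gaussAvg μ ha, lintegral_const_mul' _ _ ENNReal.ofReal_ne_top]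
    _ ≤ ENNReal.ofReal (2 ^ ((d : ℝ) / 2) * exp (π * R ^ 2)) *
        ∫⁻ w : Vᗮ, ENNReal.ofReal (gaussKer 1 w) * ENNReal.ofReal B := by
        gcongr
        exact hB _
    _ = _ := by
        rw [lintegral_mul_const' _ _ ENNReal.ofReal_ne_top, ← ofReal_integral_eq_lintegral_ofReal
          (integrable_gaussKer one_pos) (.of_forall fun _ => (gaussKer_pos one_pos _).le),
          integral_gaussKer one_pos, ENNReal.ofReal_one, one_mul,
          ← ENNReal.ofReal_mul (by positivity)]

/-- For `ξ ∈ V`, `⟨π_V x, ξ⟩ = ⟨x, ξ⟩`. -/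
lemma specPow_projMeasure (μ : Measure (Euc d)) (ξ : V) :
    specPow (projMeasure V μ) ξ = specPow μ (ξ : Euc d) := by
  unfold specPow projMeasure
  have hm : Measurable V.orthogonalProjectionOnto :=
    V.orthogonalProjectionOnto.continuous.measurable
  rw [integral_map hm.aemeasurable (by fun_prop), integral_map hm.aemeasurable (by fun_prop)]
  have e : ∀ x : Euc d, ⟪V.orthogonalProjectionOnto x, ξ⟫_ℝ = ⟪x, (ξ : Euc d)⟫_ℝ := fun x => by
    rw [Submodule.inner_orthogonalProjectionOnto_eq_of_mem_right]
  simp_rw [e]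

end Projection

/-! ### Riesz energies on the Fourier side. -/

/-- The Gamma integral, with equality for `r > 0`; at `r = 0` the left side is `0` by convention. -/
lemma ofReal_rpow_neg_le_lintegral {β r : ℝ} (hβ : 0 < β) (hr : 0 ≤ r) :
    ENNReal.ofReal (r ^ (-β)) ≤ ENNReal.ofReal (π ^ (β / 2) / Gamma (β / 2)) *
      ∫⁻ u in Ioi (0 : ℝ), ENNReal.ofReal (u ^ (β / 2 - 1)) *
        ENNReal.ofReal (exp (-(π * u * r ^ 2))) := by
  rcases hr.eq_or_lt with rfl | hr
  · rw [zero_rpow (by linarith)]; simp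
  have hG : 0 < Gamma (β / 2) := Gamma_pos_of_pos (by positivity)
  have h := Real.integral_rpow_mul_exp_neg_mul_Ioi (a := β / 2) (r := π * r ^ 2) (by positivity)
    (by positivity)
  have hpos : 0 < (1 / (π * r ^ 2)) ^ (β / 2) * Gamma (β / 2) := by positivity
  have hint : Integrable (fun t : ℝ => t ^ (β / 2 - 1) * exp (-(π * r ^ 2 * t)))
      (volume.restrict (Ioi 0)) := by
    by_contra hn
    rw [integral_undef hn] at h
    exact hpos.ne h
  have h0 : 0 ≤ᵐ[volume.restrict (Ioi 0)] fun t : ℝ =>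
      t ^ (β / 2 - 1) * exp (-(π * r ^ 2 * t)) := by
    filter_upwards [ae_restrict_mem measurableSet_Ioi] with t ht
    have : 0 < t := ht
    simp only [Pi.zero_apply]
    positivity
  have e : ∫⁻ u in Ioi (0 : ℝ), ENNReal.ofReal (u ^ (β / 2 - 1)) *
      ENNReal.ofReal (exp (-(π * u * r ^ 2))) =
      ENNReal.ofReal ((1 / (π * r ^ 2)) ^ (β / 2) * Gamma (β / 2)) := by
    rw [← h, ofReal_integral_eq_lintegral_ofReal hint h0]
    refine setLIntegral_congr_fun measurableSet_Ioi fun t ht => ?_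
    have : 0 < t := ht
    rw [← ENNReal.ofReal_mul (by positivity)]
    congr 4; ring
  rw [e, ← ENNReal.ofReal_mul (by positivity)]
  refine ENNReal.ofReal_le_ofReal (le_of_eq ?_)
  have e2 : (1 / (π * r ^ 2)) ^ (β / 2) = (π ^ (β / 2))⁻¹ * r ^ (-β) := by
    rw [one_div, inv_rpow (by positivity), mul_rpow pi_pos.le (by positivity), mul_inv,
      rpow_neg hr.le, ← rpow_natCast r 2, ← rpow_mul hr.le]
    congr 3; push_cast; ring
  rw [e2]
  have : 0 < π ^ (β / 2) := by positivity
  field_simp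

lemma measureReal_univ_le_of_isFrostman {d : ℕ} {μ : Measure (Euc d)} [IsFiniteMeasure μ]
    {s R C : ℝ} (hR : 0 < R) (hC : 0 ≤ C) (hF : IsFrostman μ s C)
    (hsupp : μ (closedBall 0 R)ᶜ = 0) : μ.real univ ≤ C * R ^ s := by
  have h : μ univ ≤ ENNReal.ofReal (C * R ^ s) := by
    rw [← union_compl_self (closedBall (0 : Euc d) R)]
    refine (measure_union_le _ _).trans ?_
    rw [hsupp, add_zero]
    exact hF 0 R hR
  exact ENNReal.toReal_le_of_le_ofReal (by positivity) h

lemma integral_gaussKer_prod_le {d : ℕ} (μ : Measure (Euc d)) [IsFiniteMeasure μ] {a B : ℝ}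
    (ha : 0 < a) (hB : ∀ z, gaussAvg μ a z ≤ B) :
    ∫ p : Euc d × Euc d, gaussKer a (p.1 - p.2) ∂(μ.prod μ) ≤ B * μ.real univ := by
  have hi : Integrable (fun p : Euc d × Euc d => gaussKer a (p.1 - p.2)) (μ.prod μ) := by
    refine Integrable.of_bound ((continuous_gaussKer _).comp
      (continuous_fst.sub continuous_snd)).aestronglyMeasurable
      (a ^ (-(Module.finrank ℝ (Euc d) : ℝ) / 2)) (.of_forall fun y => ?_)
    rw [norm_of_nonneg (gaussKer_pos ha _).le]
    exact gaussKer_le ha _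
  rw [integral_prod _ hi]
  calc _ ≤ ∫ _, B ∂μ := integral_mono hi.integral_prod_left (integrable_const B) hB
    _ = _ := by simp [mul_comm]

lemma lintegral_Ioi_ite_lt_top {α₁ α₂ : ℝ} (h₁ : -1 < α₁) (h₂ : α₂ < -1) :
    ∫⁻ u in Ioi (0 : ℝ), ENNReal.ofReal (if u ≤ 1 then u ^ α₁ else u ^ α₂) < ∞ := by
  rw [← Ioc_union_Ioi_eq_Ioi (zero_le_one (α := ℝ)), lintegral_union measurableSet_Ioi
    (Ioc_disjoint_Ioi le_rfl), ENNReal.add_lt_top]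
  constructor
  · have hi : IntegrableOn (fun u : ℝ => u ^ α₁) (Ioc 0 1) :=
      (intervalIntegrable_iff_integrableOn_Ioc_of_le zero_le_one).1
        (intervalIntegral.intervalIntegrable_rpow' h₁)
    rw [setLIntegral_congr_fun measurableSet_Ioc
      (g := fun u => ENNReal.ofReal (u ^ α₁)) fun u hu => by simp only [if_pos hu.2]]
    exact hi.lintegral_lt_top
  · have hi : IntegrableOn (fun u : ℝ => u ^ α₂) (Ioi 1) :=
      integrableOn_Ioi_rpow_of_lt h₂ one_pos
    rw [setLIntegral_congr_fun measurableSet_Ioi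
      (g := fun u => ENNReal.ofReal (u ^ α₂)) fun u hu => by
        simp only [if_neg (not_le.2 (mem_Ioi.1 hu))]]
    exact hi.lintegral_lt_top

/-- The Riesz energies of Frostman measures, written in terms of the Fourier transform, are
finite. -/
lemma exists_lintegral_rpow_mul_specPow_le (d : ℕ) {s β R : ℝ} (hβ : 0 < β) (hβd : β < d)
    (hs : d < β + s) (hR : 0 < R) :
    ∃ A : ℝ, 0 < A ∧ ∀ (μ : Measure (Euc d)) [IsFiniteMeasure μ] (C : ℝ), 0 ≤ C →
      IsFrostman μ s C → μ (closedBall 0 R)ᶜ = 0 →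
      ∫⁻ ξ : Euc d, ENNReal.ofReal (‖ξ‖ ^ (-β) * specPow μ ξ) ≤ ENNReal.ofReal (A * C ^ 2) := by
  obtain ⟨c, hc, hcF⟩ := exists_gaussAvg_le_of_isFrostman d s
  -- After writing `|ξ|^(-β)` as a superposition of Gaussians, the double integral of `K_u` decays
  -- like `u^((s-d)/2)` by Frostman for `u ≤ 1`, and like `u^(-d/2)` trivially for `u > 1`.
  -- Integrability at `0` and at `∞` is `d < β + s` and `β < d`.
  set α₁ : ℝ := β / 2 - 1 + (s - d) / 2 with hα₁
  set α₂ : ℝ := β / 2 - 1 + -(d : ℝ) / 2 with hα₂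
  have hJ := lintegral_Ioi_ite_lt_top (α₁ := α₁) (α₂ := α₂) (by rw [hα₁]; linarith)
    (by rw [hα₂]; linarith)
  set J := ∫⁻ u in Ioi (0 : ℝ), ENNReal.ofReal (if u ≤ 1 then u ^ α₁ else u ^ α₂) with hJdef
  set K : ℝ := π ^ (β / 2) / Gamma (β / 2) with hK
  have hKpos : 0 < K := by
    have : 0 < Gamma (β / 2) := Gamma_pos_of_pos (by positivity)
    positivity
  set B : ℝ := c * R ^ s + R ^ s * R ^ s with hB
  refine ⟨K * B * J.toReal + 1, by positivity, ?_⟩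
  intro μ _ C hC hF hsupp
  have hmass := measureReal_univ_le_of_isFrostman hR hC hF hsupp
  have hinner : ∀ u, 0 < u → ENNReal.ofReal (u ^ (β / 2 - 1)) *
      ∫⁻ ξ : Euc d, ENNReal.ofReal (exp (-(π * u * ‖ξ‖ ^ 2)) * specPow μ ξ) ≤
      ENNReal.ofReal (B * C ^ 2) * ENNReal.ofReal (if u ≤ 1 then u ^ α₁ else u ^ α₂) := by
    intro u hu
    rw [← ofReal_integral_eq_lintegral_ofReal (integrable_exp_mul_specPow μ hu)
      (.of_forall fun ξ => mul_nonneg (exp_pos _).le (specPow_nonneg μ ξ)),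
      integral_exp_mul_specPow μ hu, ← ENNReal.ofReal_mul (by positivity),
      ← ENNReal.ofReal_mul (by positivity)]
    refine ENNReal.ofReal_le_ofReal ?_
    split_ifs with h1
    · have h := integral_gaussKer_prod_le μ hu (hcF μ C hC hF u hu)
      calc _ ≤ u ^ (β / 2 - 1) * (c * C * u ^ ((s - d) / 2) * (C * R ^ s)) := by
            gcongr
            exact h.trans (by gcongr)
        _ = c * R ^ s * C ^ 2 * u ^ α₁ := by rw [hα₁, rpow_add hu]; ring
        _ ≤ _ := by
            gcongr
            rw [hB]
            have : 0 < R ^ s * R ^ s := by positivity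
            linarith
    · have hle : ∀ z, gaussAvg μ u z ≤ u ^ (-(d : ℝ) / 2) * μ.real univ := by
        intro z
        calc _ ≤ ∫ _, u ^ (-(d : ℝ) / 2) ∂μ := by
              refine integral_mono (integrable_gaussKer_sub μ hu z) (integrable_const _) fun y => ?_
              have := gaussKer_le hu (z - y)
              rwa [finrank_euclideanSpace, Fintype.card_fin] at this
          _ = _ := by simp [mul_comm]
      have h := integral_gaussKer_prod_le μ hu hle
      have hm0 : 0 ≤ μ.real univ := measureReal_nonneg
      calc _ ≤ u ^ (β / 2 - 1) * (u ^ (-(d : ℝ) / 2) * (C * R ^ s) * (C * R ^ s)) := by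
            gcongr
            exact h.trans (by gcongr)
        _ = R ^ s * R ^ s * C ^ 2 * u ^ α₂ := by rw [hα₂, rpow_add hu]; ring
        _ ≤ _ := by
            gcongr
            rw [hB]
            have : 0 < c * R ^ s := by positivity
            linarith
  have hm : Measurable fun q : Euc d × ℝ => ENNReal.ofReal (q.2 ^ (β / 2 - 1)) *
      (ENNReal.ofReal (exp (-(π * q.2 * ‖q.1‖ ^ 2)) * specPow μ q.1)) := by
    have h : Measurable fun q : Euc d × ℝ => specPow μ q.1 :=
      (measurable_specPow μ).comp measurable_fst
    fun_prop
  calc ∫⁻ ξ : Euc d, ENNReal.ofReal (‖ξ‖ ^ (-β) * specPow μ ξ)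
      ≤ ∫⁻ ξ : Euc d, ENNReal.ofReal K * ∫⁻ u in Ioi (0 : ℝ), ENNReal.ofReal (u ^ (β / 2 - 1)) *
        (ENNReal.ofReal (exp (-(π * u * ‖ξ‖ ^ 2)) * specPow μ ξ)) := by
        refine lintegral_mono fun ξ => ?_
        rw [ENNReal.ofReal_mul (by positivity)]
        refine (mul_le_mul_left (ofReal_rpow_neg_le_lintegral hβ (norm_nonneg ξ)) _).trans_eq ?_
        rw [mul_assoc, ← lintegral_mul_const' _ _ ENNReal.ofReal_ne_top]
        congr 2
        ext u
        rw [ENNReal.ofReal_mul (exp_pos _).le, mul_assoc]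
    _ = ENNReal.ofReal K * ∫⁻ u in Ioi (0 : ℝ), ENNReal.ofReal (u ^ (β / 2 - 1)) *
        ∫⁻ ξ : Euc d, (ENNReal.ofReal (exp (-(π * u * ‖ξ‖ ^ 2)) * specPow μ ξ)) := by
        rw [lintegral_const_mul' _ _ ENNReal.ofReal_ne_top,
          lintegral_lintegral_swap hm.aemeasurable]
        simp_rw [lintegral_const_mul' _ _ ENNReal.ofReal_ne_top]
    _ ≤ ENNReal.ofReal K * ∫⁻ u in Ioi (0 : ℝ), ENNReal.ofReal (B * C ^ 2) *
        ENNReal.ofReal (if u ≤ 1 then u ^ α₁ else u ^ α₂) := by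
        gcongr 1
        exact setLIntegral_mono' measurableSet_Ioi fun u hu => hinner u hu
    _ = ENNReal.ofReal (K * B * J.toReal * C ^ 2) := by
        rw [lintegral_const_mul' _ _ ENNReal.ofReal_ne_top, ← hJdef,
          ← ENNReal.ofReal_toReal hJ.ne, ← ENNReal.ofReal_mul (by positivity),
          ← ENNReal.ofReal_mul (by positivity), ENNReal.toReal_ofReal (by positivity)]
        congr 1; ring
    _ ≤ _ := by
        refine ENNReal.ofReal_le_ofReal ?_
        gcongr
        linarith

/-! ### Integral geometry on the Grassmannian. -/

/-- Integration in polar coordinates of radial functions. -/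
lemma lintegral_fun_norm {E : Type*} [NormedAddCommGroup E] [InnerProductSpace ℝ E]
    [MeasurableSpace E] [FiniteDimensional ℝ E] [BorelSpace E] [Nontrivial E] {f : ℝ → ℝ≥0∞}
    (hf : Measurable f) :
    ∫⁻ x : E, f ‖x‖ = (volume : Measure E).toSphere univ *
      ∫⁻ r in Ioi (0 : ℝ), ENNReal.ofReal (r ^ (Module.finrank ℝ E - 1)) * f r := by
  have hm : Measurable fun q : sphere (0 : E) 1 × Ioi (0 : ℝ) => f q.2 :=
    hf.comp (measurable_subtype_coe.comp measurable_snd)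
  have hm' : Measurable fun r : Ioi (0 : ℝ) => f r := hf.comp measurable_subtype_coe
  calc ∫⁻ x : E, f ‖x‖ = ∫⁻ x : ({(0)}ᶜ : Set E), f ‖x.1‖ ∂((volume : Measure E).comap (↑)) := by
        rw [lintegral_subtype_comap (measurableSet_singleton _).compl fun x : E => f ‖x‖,
          restrict_compl_singleton]
    _ = ∫⁻ q, f q.2 ∂((volume : Measure E).toSphere.prod
          (.volumeIoiPow (Module.finrank ℝ E - 1))) := by
        rw [← (volume : Measure E).measurePreserving_homeomorphUnitSphereProd.lintegral_comp hm]
        simp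
    _ = (volume : Measure E).toSphere univ *
          ∫⁻ r : Ioi (0 : ℝ), f r ∂.volumeIoiPow (Module.finrank ℝ E - 1) := by
        rw [lintegral_prod _ hm.aemeasurable]
        simp [mul_comm]
    _ = _ := by
        rw [Measure.volumeIoiPow, lintegral_withDensity_eq_lintegral_mul _ (by fun_prop) hm',
          ← lintegral_subtype_comap measurableSet_Ioi]
        rfl

instance {d n : ℕ} : SecondCountableTopology (Grass d n) := by
  have : ProperSpace (Euc d →L[ℝ] Euc d) := FiniteDimensional.proper ℝ _
  exact TopologicalSpace.secondCountableTopology_induced _ _ _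

lemma Grass.continuous_starProjection_apply {d n : ℕ} :
    Continuous fun q : Grass d n × Euc d => q.1.1.starProjection q.2 := by
  have h : Continuous fun V : Grass d n => V.1.starProjection := continuous_induced_dom
  exact (h.comp continuous_fst).clm_apply continuous_snd

/-- Integrals over a subspace as integrals over the whole space. -/
lemma lintegral_submodule_eq {d : ℕ} (V : Submodule ℝ (Euc d)) {H : Euc d → ℝ≥0∞}
    (hH : Measurable H) :
    ∫⁻ ξ : V, H ξ = ∫⁻ y : Euc d, H (V.starProjection y) *
      ENNReal.ofReal (exp (-(π * ‖y - V.starProjection y‖ ^ 2))) := by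
  have hmp : MeasurePreserving (fun y : Euc d => WithLp.ofLp (V.orthogonalDecomposition y))
      volume (volume.prod volume) :=
    (WithLp.volume_preserving_ofLp _ _).comp V.orthogonalDecomposition.measurePreserving
  have hm : Measurable fun q : V × Vᗮ => H q.1 * ENNReal.ofReal (gaussKer 1 q.2) :=
    (hH.comp (measurable_subtype_coe.comp measurable_fst)).mul
      ((continuous_gaussKer 1).comp continuous_snd).measurable.ennreal_ofReal
  have h1 : ∫⁻ y : Euc d, H (V.starProjection y) *
      ENNReal.ofReal (exp (-(π * ‖y - V.starProjection y‖ ^ 2))) =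
      ∫⁻ q : V × Vᗮ, H q.1 * ENNReal.ofReal (gaussKer 1 q.2) ∂(volume.prod volume) := by
    rw [← hmp.lintegral_comp hm]
    refine lintegral_congr fun y => ?_
    have e : y - V.starProjection y = ((Vᗮ.orthogonalProjectionOnto y : Vᗮ) : Euc d) := by
      rw [sub_eq_iff_eq_add']
      simp
    rw [e]
    simp [gaussKer]
  rw [h1, lintegral_prod _ hm.aemeasurable]
  have h2 : ∫⁻ w : Vᗮ, ENNReal.ofReal (gaussKer 1 w) = 1 := by
    rw [← ofReal_integral_eq_lintegral_ofReal (integrable_gaussKer one_pos)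
      (.of_forall fun _ => (gaussKer_pos one_pos _).le), integral_gaussKer one_pos,
      ENNReal.ofReal_one]
  refine lintegral_congr fun ξ => ?_
  dsimp only
  rw [lintegral_const_mul _ (continuous_gaussKer 1).measurable.ennreal_ofReal, h2, mul_one]

/-- The domain of integration varies with `V`; `lintegral_submodule_eq` replaces it by `ℝ^d`, where
joint measurability suffices. -/
lemma Grass.measurable_lintegral {d n : ℕ} {F : Grass d n × Euc d → ℝ≥0∞} (hF : Measurable F) :
    Measurable fun V : Grass d n => ∫⁻ ξ : V.1, F (V, ξ) := by
  have e : ∀ V : Grass d n, ∫⁻ ξ : V.1, F (V, ξ) = ∫⁻ y : Euc d, F (V, V.1.starProjection y) *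
      ENNReal.ofReal (exp (-(π * ‖y - V.1.starProjection y‖ ^ 2))) := fun V =>
    lintegral_submodule_eq V.1 (hF.comp measurable_prodMk_left)
  simp_rw [e]
  have hc := Grass.continuous_starProjection_apply (d := d) (n := n)
  refine Measurable.lintegral_prod_right' (f := fun q : Grass d n × Euc d =>
    F (q.1, q.1.1.starProjection q.2) *
      ENNReal.ofReal (exp (-(π * ‖q.2 - q.1.1.starProjection q.2‖ ^ 2)))) ?_
  refine (hF.comp (measurable_fst.prodMk hc.measurable)).mul ?_
  have : Continuous fun q : Grass d n × Euc d =>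
      exp (-(π * ‖q.2 - q.1.1.starProjection q.2‖ ^ 2)) := by fun_prop
  exact this.measurable.ennreal_ofReal

instance (d : ℕ) : IsProbabilityMeasure (orthHaar d) := ⟨haarMeasure_self (K₀ := ⊤)⟩

instance (d : ℕ) : (orthHaar d).IsMulLeftInvariant := by
  unfold orthHaar; infer_instance

/-- A right translate of Haar measure is again a left-invariant probability measure, so uniqueness
identifies the two. -/
instance (d : ℕ) : (orthHaar d).IsMulRightInvariant := by
  refine ⟨fun g => ?_⟩
  have : IsProbabilityMeasure ((orthHaar d).map (· * g)) :=
    isProbabilityMeasure_map (measurable_mul_const g).aemeasurable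
  have h := haarMeasure_unique ((orthHaar d).map (· * g)) ⊤
  rw [TopologicalSpace.PositiveCompacts.coe_top, measure_univ, one_smul] at h
  exact h

lemma continuous_orthGroup_apply (d : ℕ) :
    Continuous fun q : OrthGroup d × Euc d => (q.1 : Euc d →L[ℝ] Euc d) q.2 :=
  (continuous_subtype_val.comp continuous_fst).clm_apply continuous_snd

/-- The average over all rotations. -/
def radialAvg {d : ℕ} (H : Euc d → ℝ≥0∞) (ξ : Euc d) : ℝ≥0∞ :=
  ∫⁻ g : OrthGroup d, H ((g : Euc d →L[ℝ] Euc d) ξ) ∂(orthHaar d)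

lemma exists_orthGroup_apply_eq {d : ℕ} {v w : Euc d} (h : ‖v‖ = ‖w‖) :
    ∃ g : OrthGroup d, (g : Euc d →L[ℝ] Euc d) v = w := by
  refine ⟨Unitary.linearIsometryEquiv.symm (Submodule.reflection (ℝ ∙ (v - w))ᗮ), ?_⟩
  simpa using Submodule.reflection_sub h

/-- `O(d)` is transitive on spheres, and passing from `v` to `k v` is a right translation by `k`. -/
lemma radialAvg_eq_of_norm_eq {d : ℕ} (H : Euc d → ℝ≥0∞) {v w : Euc d} (h : ‖v‖ = ‖w‖) :
    radialAvg H v = radialAvg H w := by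
  obtain ⟨k, rfl⟩ := exists_orthGroup_apply_eq h
  unfold radialAvg
  exact (lintegral_mul_right_eq_self (μ := orthHaar d)
    (fun g : OrthGroup d => H ((g : Euc d →L[ℝ] Euc d) v)) k).symm

lemma measurable_radialAvg {d : ℕ} {H : Euc d → ℝ≥0∞} (hH : Measurable H) :
    Measurable (radialAvg H) := by
  have : Measurable fun q : Euc d × OrthGroup d => H ((q.2 : Euc d →L[ℝ] Euc d) q.1) :=
    hH.comp ((continuous_orthGroup_apply d).measurable.comp measurable_swap)
  exact this.lintegral_prod_right'

lemma radialAvg_eq {d : ℕ} (H : Euc d → ℝ≥0∞) {e : Euc d} (he : ‖e‖ = 1) (ξ : Euc d) :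
    radialAvg H ξ = radialAvg H (‖ξ‖ • e) :=
  radialAvg_eq_of_norm_eq H (by simp [norm_smul, he])

lemma lintegral_rotate {d n : ℕ} (g : OrthGroup d) (V : Grass d n) {H : Euc d → ℝ≥0∞}
    (hH : Measurable H) :
    ∫⁻ ξ : (V.rotate g).1, H ξ = ∫⁻ ξ : V.1, H ((g : Euc d →L[ℝ] Euc d) ξ) := by
  have hmp := ((Unitary.linearIsometryEquiv g).submoduleMap V.1).measurePreserving
  have := hmp.lintegral_comp (f := fun ξ => H ξ) (hH.comp measurable_subtype_coe)
  exact this.symm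

/-- The integral-geometric formula for the Grassmannian. -/
lemma exists_lintegral_grassMeasure_le {d n : ℕ} (hn : 0 < n) (hnd : n ≤ d) :
    ∃ c : ℝ≥0∞, c ≠ ∞ ∧ ∀ H : Euc d → ℝ≥0∞, Measurable H →
      ∫⁻ V : Grass d n, (∫⁻ ξ : V.1, H ξ) ∂(grassMeasure hnd) ≤
        c * ∫⁻ ξ : Euc d, ENNReal.ofReal (‖ξ‖ ^ ((n : ℝ) - d)) * H ξ := by
  have hd : 0 < d := hn.trans_le hnd
  set V₀ : Grass d n := Grass.coordPlane hnd with hV₀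
  have : Nontrivial V₀.1 := Module.nontrivial_of_finrank_pos (R := ℝ) (by rw [V₀.2]; exact hn)
  have : Nonempty (Fin d) := ⟨⟨0, hd⟩⟩
  have : Nontrivial (Euc d) := Module.nontrivial_of_finrank_pos (R := ℝ) (by simpa using hd)
  set cn := (volume : Measure V₀.1).toSphere univ with hcn
  set cd := (volume : Measure (Euc d)).toSphere univ with hcd
  have hcn_top : cn ≠ ∞ := measure_ne_top _ _
  have hcd_top : cd ≠ ∞ := measure_ne_top _ _
  have hcd_zero : cd ≠ 0 := by
    rw [hcd, toSphere_apply_univ]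
    refine mul_ne_zero ?_ (measure_ball_pos _ _ one_pos).ne'
    simpa using hd.ne'
  -- The ratio of the sphere areas. In polar coordinates both sides become multiples of `∫ r^(n-1)
  -- h(r) dr` with `h` the radial average of `H`; equality holds in fact.
  refine ⟨cn / cd, ENNReal.div_ne_top hcn_top hcd_zero, fun H hH => ?_⟩
  set e : Euc d := EuclideanSpace.single ⟨0, hd⟩ 1 with he
  have he1 : ‖e‖ = 1 := by simp [he]
  set h : ℝ → ℝ≥0∞ := fun r => radialAvg H (r • e) with hh
  have hhm : Measurable h := (measurable_radialAvg hH).comp (by fun_prop)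
  have hrad : ∀ ξ, radialAvg H ξ = h ‖ξ‖ := fun ξ => radialAvg_eq H he1 ξ
  have hVm : Measurable fun V : Grass d n => ∫⁻ ξ : V.1, H ξ :=
    Grass.measurable_lintegral (F := fun q => H q.2) (hH.comp measurable_snd)
  have hm2 : Measurable fun q : OrthGroup d × Euc d => H ((q.1 : Euc d →L[ℝ] Euc d) q.2) :=
    hH.comp (continuous_orthGroup_apply d).measurable
  have hm1 : Measurable fun q : OrthGroup d × V₀.1 => H ((q.1 : Euc d →L[ℝ] Euc d) q.2) :=
    hm2.comp (measurable_fst.prodMk (measurable_subtype_coe.comp measurable_snd))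
  have hL : ∫⁻ V : Grass d n, (∫⁻ ξ : V.1, H ξ) ∂(grassMeasure hnd) =
      cn * ∫⁻ r in Ioi (0 : ℝ), ENNReal.ofReal (r ^ (n - 1)) * h r := by
    rw [grassMeasure, lintegral_map hVm (Grass.continuous_rotate _).measurable]
    simp_rw [lintegral_rotate _ _ hH]
    rw [lintegral_lintegral_swap hm1.aemeasurable]
    change ∫⁻ ξ : V₀.1, radialAvg H ξ = _
    simp_rw [hrad]
    have := lintegral_fun_norm (E := V₀.1) hhm
    rw [V₀.2] at this
    exact this
  have hR : ∫⁻ ξ : Euc d, ENNReal.ofReal (‖ξ‖ ^ ((n : ℝ) - d)) * H ξ =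
      cd * ∫⁻ r in Ioi (0 : ℝ), ENNReal.ofReal (r ^ (n - 1)) * h r := by
    have hm3 : Measurable fun q : OrthGroup d × Euc d => ENNReal.ofReal (‖q.2‖ ^ ((n : ℝ) - d)) *
        H ((q.1 : Euc d →L[ℝ] Euc d) q.2) := Measurable.mul (by fun_prop) hm2
    -- The weight and Lebesgue measure are rotation invariant, so `H` may be rotated by `g` and then
    -- averaged over `g`.
    have h1 : ∀ g : OrthGroup d, ∫⁻ ξ : Euc d, ENNReal.ofReal (‖ξ‖ ^ ((n : ℝ) - d)) * H ξ =
        ∫⁻ ξ : Euc d, ENNReal.ofReal (‖ξ‖ ^ ((n : ℝ) - d)) *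
          H ((g : Euc d →L[ℝ] Euc d) ξ) := by
      intro g
      have hmp := (Unitary.linearIsometryEquiv g).measurePreserving
      have hm4 : Measurable fun ξ : Euc d => ENNReal.ofReal (‖ξ‖ ^ ((n : ℝ) - d)) * H ξ :=
        Measurable.mul (by fun_prop) hH
      rw [← hmp.lintegral_comp hm4]
      refine lintegral_congr fun ξ => ?_
      rw [LinearIsometryEquiv.norm_map]
      rfl
    calc _ = ∫⁻ _ : OrthGroup d, (∫⁻ ξ : Euc d, ENNReal.ofReal (‖ξ‖ ^ ((n : ℝ) - d)) * H ξ)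
          ∂(orthHaar d) := by simp
      _ = ∫⁻ g : OrthGroup d, (∫⁻ ξ : Euc d, ENNReal.ofReal (‖ξ‖ ^ ((n : ℝ) - d)) *
          H ((g : Euc d →L[ℝ] Euc d) ξ)) ∂(orthHaar d) := lintegral_congr h1
      _ = ∫⁻ ξ : Euc d, ENNReal.ofReal (‖ξ‖ ^ ((n : ℝ) - d)) * radialAvg H ξ := by
          rw [lintegral_lintegral_swap hm3.aemeasurable]
          simp_rw [lintegral_const_mul' _ _ ENNReal.ofReal_ne_top]
          rfl
      _ = _ := by
          simp_rw [hrad]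
          have := lintegral_fun_norm (E := Euc d)
            (f := fun r => ENNReal.ofReal (r ^ ((n : ℝ) - d)) * h r) (by fun_prop)
          rw [this, finrank_euclideanSpace, Fintype.card_fin]
          congr 1
          refine setLIntegral_congr_fun measurableSet_Ioi fun r hr => ?_
          have hr : 0 < r := hr
          rw [← mul_assoc, ← ENNReal.ofReal_mul (by positivity)]
          congr 2
          rw [← rpow_natCast, ← rpow_natCast, ← rpow_add hr, Nat.cast_sub hn, Nat.cast_sub hd]
          congr 1
          push_cast; ring
  rw [hL, hR, ← mul_assoc, ENNReal.div_mul_cancel hcd_zero hcd_top]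

lemma lintegral_le_lintegral_rpow_mul {α : Type*} [MeasurableSpace α] (κ : Measure α) {p : ℝ}
    (hp : 1 < p) {f : α → ℝ≥0∞} (hf : AEMeasurable f κ) :
    ∫⁻ x, f x ∂κ ≤ (∫⁻ x, f x ^ p ∂κ) ^ (1 / p) * κ univ ^ (1 / p.conjExponent) := by
  have h := ENNReal.lintegral_mul_le_Lp_mul_Lq κ (Real.HolderConjugate.conjExponent hp) hf
    (aemeasurable_const (b := (1 : ℝ≥0∞)))
  simpa using h

lemma lintegral_rpow_le_of_isProbabilityMeasure {α : Type*} [MeasurableSpace α] (κ : Measure α)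
    [IsProbabilityMeasure κ] {p : ℝ} (hp : 1 < p) {f : α → ℝ≥0∞} (hf : AEMeasurable f κ) :
    (∫⁻ x, f x ∂κ) ^ p ≤ ∫⁻ x, f x ^ p ∂κ := by
  have h := lintegral_le_lintegral_rpow_mul κ hp hf
  rw [measure_univ, ENNReal.one_rpow, mul_one] at h
  calc _ ≤ ((∫⁻ x, f x ^ p ∂κ) ^ (1 / p)) ^ p := by gcongr
    _ = _ := by rw [← ENNReal.rpow_mul, one_div, inv_mul_cancel₀ (by linarith), ENNReal.rpow_one]

/-! ### Averages over balls, absolute continuity and densities. -/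

section BallAverages

variable {E : Type*} [NormedAddCommGroup E] [InnerProductSpace ℝ E] [MeasurableSpace E]
  [FiniteDimensional ℝ E] [BorelSpace E] (ν : Measure E)

/-- The average density of a measure in a closed ball. -/
def ballAvg (r : ℝ) (x : E) : ℝ≥0∞ := ν (closedBall x r) / volume (closedBall x r)

lemma measurableSet_dist_le (r : ℝ) : MeasurableSet {q : E × E | dist q.2 q.1 ≤ r} :=
  (isClosed_le (continuous_snd.dist continuous_fst) continuous_const).measurableSet

lemma measurable_measure_closedBall' [SFinite ν] (r : ℝ) :
    Measurable fun x => ν (closedBall x r) :=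
  measurable_measure_prodMk_left (measurableSet_dist_le (E := E) r)

lemma measurable_ballAvg [SFinite ν] (r : ℝ) : Measurable (ballAvg ν r) :=
  (measurable_measure_closedBall' ν r).div (measurable_measure_closedBall' volume r)

lemma volume_closedBall_ne_zero {r : ℝ} (hr : 0 < r) (x : E) :
    (volume : Measure E) (closedBall x r) ≠ 0 := (measure_closedBall_pos _ _ hr).ne'

lemma volume_closedBall_ne_top (r : ℝ) (x : E) :
    (volume : Measure E) (closedBall x r) ≠ ∞ := measure_closedBall_lt_top.ne

/-- Tonelli, using that `dist x y ≤ r` is symmetric and that balls of radius `r` have equal volume.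
-/
lemma setLIntegral_ballAvg [SFinite ν] (r : ℝ) (U : Set E) :
    ∫⁻ x in U, ballAvg ν r x =
      ∫⁻ y, volume (U ∩ closedBall y r) / volume (closedBall (0 : E) r) ∂ν := by
  have h1 : ∀ x : E, ballAvg ν r x =
      ∫⁻ y, {q : E × E | dist q.2 q.1 ≤ r}.indicator 1 (x, y) / volume (closedBall (0 : E) r)
        ∂ν := by
    intro x
    have hm : MeasurableSet (closedBall x r) := measurableSet_closedBall
    have : (fun y => {q : E × E | dist q.2 q.1 ≤ r}.indicator (1 : E × E → ℝ≥0∞) (x, y) /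
        volume (closedBall (0 : E) r)) =
        fun y => (volume (closedBall (0 : E) r))⁻¹ * (closedBall x r).indicator 1 y := by
      funext y
      simp [indicator, div_eq_mul_inv, mul_comm]
    rw [this, lintegral_const_mul _ (measurable_one.indicator hm), lintegral_indicator_one hm,
      ballAvg, div_eq_mul_inv, mul_comm, Measure.addHaar_closedBall_center]
  have hm2 : Measurable fun q : E × E => {q : E × E | dist q.2 q.1 ≤ r}.indicator
      (1 : E × E → ℝ≥0∞) (q.1, q.2) / volume (closedBall (0 : E) r) :=
    (measurable_one.indicator (measurableSet_dist_le r)).div_const _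
  simp_rw [h1]
  rw [lintegral_lintegral_swap hm2.aemeasurable]
  refine lintegral_congr fun y => ?_
  have hm : MeasurableSet (closedBall y r) := measurableSet_closedBall
  have : (fun x => {q : E × E | dist q.2 q.1 ≤ r}.indicator (1 : E × E → ℝ≥0∞) (x, y) /
      volume (closedBall (0 : E) r)) =
      fun x => (volume (closedBall (0 : E) r))⁻¹ * (closedBall y r).indicator 1 x := by
    funext x
    simp [indicator, div_eq_mul_inv, mul_comm, dist_comm]
  rw [this, lintegral_const_mul _ (measurable_one.indicator hm), lintegral_indicator_one hm,
    Measure.restrict_apply hm, div_eq_mul_inv, mul_comm, inter_comm]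

/-- The radii `1 / (m + 1)`. -/
def radius (m : ℕ) : ℝ := 1 / ((m : ℝ) + 1)

lemma radius_pos (m : ℕ) : 0 < radius m := by unfold radius; positivity

lemma tendsto_radius : Tendsto radius atTop (𝓝[>] 0) :=
  tendsto_nhdsWithin_iff.2 ⟨tendsto_one_div_add_atTop_nhds_zero_nat, .of_forall radius_pos⟩

/-- Small balls about a point of `U` lie in `U`, so the integrand of `setLIntegral_ballAvg` is
eventually `1` there; then Fatou. -/
lemma measure_le_liminf_setLIntegral_ballAvg [SFinite ν] {U : Set E} (hU : IsOpen U) :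
    ν U ≤ liminf (fun m => ∫⁻ x in U, ballAvg ν (radius m) x) atTop := by
  simp_rw [setLIntegral_ballAvg ν]
  have hm : ∀ m, Measurable fun y : E =>
      volume (U ∩ closedBall y (radius m)) / volume (closedBall (0 : E) (radius m)) := by
    intro m
    refine Measurable.div_const ?_ _
    have := measurable_measure_closedBall' ((volume : Measure E).restrict U) (radius m)
    simpa [Measure.restrict_apply measurableSet_closedBall, inter_comm] using this
  refine le_trans ?_ (lintegral_liminf_le hm)
  rw [← lintegral_indicator_one hU.measurableSet]
  refine lintegral_mono fun y => ?_
  by_cases hy : y ∈ U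
  · rw [indicator_of_mem hy]
    refine le_liminf_of_le (by isBoundedDefault) ?_
    obtain ⟨ε, hε, hεU⟩ := Metric.isOpen_iff.1 hU y hy
    have : ∀ᶠ m in atTop, radius m < ε :=
      (tendsto_nhds_of_tendsto_nhdsWithin tendsto_radius).eventually (gt_mem_nhds hε)
    filter_upwards [this] with m hm
    rw [inter_eq_right.2 ((closedBall_subset_ball hm).trans hεU),
      Measure.addHaar_closedBall_center, ENNReal.div_self (volume_closedBall_ne_zero
        (radius_pos m) _) (volume_closedBall_ne_top _ _)]
    exact le_rfl
  · rw [indicator_of_notMem hy]; exact zero_le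

variable [IsFiniteMeasure ν]

/-- A measure whose average densities are bounded in `L^p` along a sequence is absolutely
continuous. -/
lemma absolutelyContinuous_of_liminf_lt_top {p : ℝ} (hp : 1 < p)
    (h : liminf (fun m => ∫⁻ x, ballAvg ν (radius m) x ^ p) atTop < ∞) :
    ν ≪ (volume : Measure E) := by
  obtain ⟨M, hM1, hM2⟩ := exists_between h
  have hfreq : ∃ᶠ m in atTop, ∫⁻ x, ballAvg ν (radius m) x ^ p < M :=
    frequently_lt_of_liminf_lt (by isBoundedDefault) hM1
  have hq : 0 < 1 / p.conjExponent :=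
    one_div_pos.2 (Real.HolderConjugate.conjExponent hp).symm.pos
  -- Hölder on `U`. A null set lies in open sets of arbitrarily small volume, so its `ν`-measure
  -- vanishes.
  have hU : ∀ U : Set E, IsOpen U →
      ν U ≤ M ^ (1 / p) * (volume U) ^ (1 / p.conjExponent) := by
    intro U hU
    refine (measure_le_liminf_setLIntegral_ballAvg ν hU).trans ?_
    refine liminf_le_of_frequently_le' (hfreq.mono fun m hm => ?_)
    refine (lintegral_le_lintegral_rpow_mul _ hp (measurable_ballAvg ν _).aemeasurable).trans ?_
    rw [Measure.restrict_apply_univ]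
    gcongr
    exact (setLIntegral_le_lintegral _ _).trans hm.le
  have hMtop : M ^ (1 / p) ≠ ∞ :=
    ENNReal.rpow_ne_top_of_nonneg (one_div_nonneg.2 (by linarith)) hM2.ne
  intro S hS
  have htend : Tendsto (fun ε : ℝ≥0∞ => M ^ (1 / p) * ε ^ (1 / p.conjExponent)) (𝓝[>] 0)
      (𝓝 0) := by
    have h1 : Tendsto (fun ε : ℝ≥0∞ => ε ^ (1 / p.conjExponent)) (𝓝 0) (𝓝 0) := by
      have := (ENNReal.continuous_rpow_const (y := 1 / p.conjExponent)).tendsto 0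
      rwa [ENNReal.zero_rpow_of_pos hq] at this
    have h2 := ENNReal.Tendsto.const_mul h1 (Or.inr hMtop)
    rw [mul_zero] at h2
    exact h2.mono_left nhdsWithin_le_nhds
  refine le_antisymm (ge_of_tendsto htend ?_) zero_le
  filter_upwards [self_mem_nhdsWithin] with ε hε
  have hε : 0 < ε := hε
  obtain ⟨U, hSU, hUo, hUε⟩ := S.exists_isOpen_lt_of_lt (μ := volume) ε (by rw [hS]; exact hε)
  refine (measure_mono hSU).trans ((hU U hUo).trans ?_)
  gcongr

/-- Differentiation of measures almost everywhere, and Fatou. -/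
lemma lintegral_rnDeriv_rpow_le_liminf (p : ℝ) :
    ∫⁻ x, ν.rnDeriv volume x ^ p ≤ liminf (fun m => ∫⁻ x, ballAvg ν (radius m) x ^ p) atTop := by
  refine le_trans ?_ (lintegral_liminf_le fun m => (measurable_ballAvg ν _).pow_const p)
  refine lintegral_mono_ae ?_
  filter_upwards [Besicovitch.ae_tendsto_rnDeriv ν (volume : Measure E)] with x hx
  have h1 := hx.comp tendsto_radius
  have h2 := ((ENNReal.continuous_rpow_const (y := p)).tendsto _).comp h1
  exact h2.liminf_eq.ge

/-- Jensen on each ball bounds the power of the average by the average of `f ^ p`, and averaging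
over balls preserves total mass. -/
lemma lintegral_ballAvg_rpow_le {p r : ℝ} (hp : 1 < p) (hr : 0 < r)
    (hac : ν ≪ (volume : Measure E)) :
    ∫⁻ x, ballAvg ν r x ^ p ≤ ∫⁻ x, ν.rnDeriv volume x ^ p := by
  set f := ν.rnDeriv (volume : Measure E) with hf
  have hfm : Measurable f := measurable_rnDeriv _ _
  set ρ := (volume : Measure E).withDensity fun x => f x ^ p with hρ
  have hpt : ∀ x, ballAvg ν r x ^ p ≤ ballAvg ρ r x := by
    intro x
    set v := volume (closedBall x r) with hv
    set κ := v⁻¹ • (volume : Measure E).restrict (closedBall x r) with hκ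
    have hκp : IsProbabilityMeasure κ := ⟨by
      rw [hκ, Measure.smul_apply, Measure.restrict_apply_univ, smul_eq_mul,
        ENNReal.inv_mul_cancel (volume_closedBall_ne_zero hr _) (volume_closedBall_ne_top _ _)]⟩
    have e1 : ballAvg ν r x = ∫⁻ y, f y ∂κ := by
      rw [hκ, lintegral_smul_measure, smul_eq_mul, hf, setLIntegral_rnDeriv hac, ballAvg,
        div_eq_mul_inv, mul_comm]
    have e2 : ballAvg ρ r x = ∫⁻ y, f y ^ p ∂κ := by
      rw [hκ, lintegral_smul_measure, smul_eq_mul, ballAvg, hρ,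
        withDensity_apply _ measurableSet_closedBall, div_eq_mul_inv, mul_comm]
    rw [e1, e2]
    exact lintegral_rpow_le_of_isProbabilityMeasure κ hp hfm.aemeasurable
  calc _ ≤ ∫⁻ x, ballAvg ρ r x := lintegral_mono hpt
    _ = ∫⁻ x in univ, ballAvg ρ r x := by rw [Measure.restrict_univ]
    _ = ρ univ := by
      rw [setLIntegral_ballAvg ρ]
      simp_rw [univ_inter, Measure.addHaar_closedBall_center]
      rw [ENNReal.div_self (volume_closedBall_ne_zero hr _) (volume_closedBall_ne_top _ _)]
      simp
    _ = _ := by rw [hρ, withDensity_apply _ MeasurableSet.univ, Measure.restrict_univ]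

end BallAverages

/-! ### The `L^p` norm of a measure as a limit. -/

section LpNorm

variable {d : ℕ} {V : Submodule ℝ (Euc d)} (ν : Measure V)

lemma measureLpNorm_rpow_of_ac {p : ℝ} (hp : 0 < p) (hac : ν ≪ (volume : Measure V)) :
    measureLpNorm ν p ^ p = ∫⁻ x, ν.rnDeriv volume x ^ p := by
  rw [measureLpNorm, if_pos hac, eLpNorm_eq_lintegral_rpow_enorm_toReal
    (by simpa using hp) ENNReal.ofReal_ne_top, ENNReal.toReal_ofReal hp.le, ← ENNReal.rpow_mul,
    one_div, inv_mul_cancel₀ hp.ne', ENNReal.rpow_one]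
  simp

lemma measureLpNorm_rpow_of_not_ac {p : ℝ} (hp : 0 < p) (hac : ¬ν ≪ (volume : Measure V)) :
    measureLpNorm ν p ^ p = ∞ := by
  rw [measureLpNorm, if_neg hac, ENNReal.top_rpow_of_pos hp]

/-- The `L^p` norm of a measure as a limit of the `L^p` norms of its average densities. -/
lemma measureLpNorm_rpow_eq_liminf [IsFiniteMeasure ν] {p : ℝ} (hp : 1 < p) :
    measureLpNorm ν p ^ p = liminf (fun m => ∫⁻ x, ballAvg ν (radius m) x ^ p) atTop := by
  by_cases hac : ν ≪ (volume : Measure V)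
  · rw [measureLpNorm_rpow_of_ac ν (by linarith) hac]
    refine le_antisymm (lintegral_rnDeriv_rpow_le_liminf ν p) ?_
    exact liminf_le_of_frequently_le' (.of_forall fun m =>
      lintegral_ballAvg_rpow_le ν hp (radius_pos m) hac)
  · rw [measureLpNorm_rpow_of_not_ac ν (by linarith) hac]
    by_contra hne
    exact hac (absolutelyContinuous_of_liminf_lt_top ν hp (lt_top_iff_ne_top.2 (Ne.symm hne)))

lemma measureLpNorm_one_of_ac [IsFiniteMeasure ν] (hac : ν ≪ (volume : Measure V)) :
    measureLpNorm ν 1 ^ (1 : ℝ) = ν univ := by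
  rw [measureLpNorm_rpow_of_ac ν one_pos hac]
  simp [lintegral_rnDeriv hac]

/-- Pointwise `t^p ≤ t + t²`; without absolute continuity the right side is `∞`. -/
lemma measureLpNorm_rpow_le [IsFiniteMeasure ν] {p : ℝ} (hp : 1 ≤ p) (hp2 : p ≤ 2) :
    measureLpNorm ν p ^ p ≤ ν univ + measureLpNorm ν 2 ^ (2 : ℝ) := by
  by_cases hac : ν ≪ (volume : Measure V)
  · rw [measureLpNorm_rpow_of_ac ν (by linarith) hac, measureLpNorm_rpow_of_ac ν two_pos hac,
      ← lintegral_rnDeriv hac, ← lintegral_add_left (measurable_rnDeriv _ _)]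
    refine lintegral_mono fun x => ?_
    rcases le_total (ν.rnDeriv volume x) 1 with h | h
    · refine le_add_right ?_
      simpa using ENNReal.rpow_le_rpow_of_exponent_ge h hp
    · exact le_add_left (ENNReal.rpow_le_rpow_of_exponent_le h hp2)
  · rw [measureLpNorm_rpow_of_not_ac ν two_pos hac]
    simp

end LpNorm

/-- The constant in the comparison of averages over balls and Gaussian averages. -/
def ballConst (n : ℕ) : ℝ := exp π * (√π ^ n / Gamma (n / 2 + 1))⁻¹

lemma ballConst_pos (n : ℕ) : 0 < ballConst n := by
  have : 0 < Gamma ((n : ℝ) / 2 + 1) := Gamma_pos_of_pos (by positivity)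
  unfold ballConst
  positivity

/-- On the ball of radius `r` the kernel `K_(r²)` is at least `exp(-π) r^(-n)`. -/
lemma ballAvg_le_gaussAvg {E : Type*} [NormedAddCommGroup E] [InnerProductSpace ℝ E]
    [MeasurableSpace E] [FiniteDimensional ℝ E] [BorelSpace E] [Nontrivial E] (ν : Measure E)
    [IsFiniteMeasure ν] {r : ℝ} (hr : 0 < r) (x : E) :
    ballAvg ν r x ≤ ENNReal.ofReal (ballConst (Module.finrank ℝ E) * gaussAvg ν (r ^ 2) x) := by
  set n := Module.finrank ℝ E with hn
  have hG : 0 < Gamma ((n : ℝ) / 2 + 1) := Gamma_pos_of_pos (by positivity)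
  set w : ℝ := √π ^ n / Gamma (n / 2 + 1) with hw
  have hwpos : 0 < w := by positivity
  have hvol : volume (closedBall x r) = ENNReal.ofReal (r ^ n * w) := by
    rw [InnerProductSpace.volume_closedBall, ← ENNReal.ofReal_pow hr.le,
      ← ENNReal.ofReal_mul (by positivity)]
  have hν : ν (closedBall x r) ≤ ENNReal.ofReal (exp π * r ^ n) *
      ENNReal.ofReal (gaussAvg ν (r ^ 2) x) := by
    rw [ofReal_gaussAvg ν (by positivity), ← lintegral_const_mul' _ _ ENNReal.ofReal_ne_top,
      ← lintegral_indicator_one measurableSet_closedBall]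
    refine lintegral_mono fun y => ?_
    by_cases hy : y ∈ closedBall x r
    · rw [indicator_of_mem hy, Pi.one_apply, ← ENNReal.ofReal_mul (by positivity),
        ← ENNReal.ofReal_one]
      refine ENNReal.ofReal_le_ofReal ?_
      rw [mem_closedBall, dist_comm, dist_eq_norm] at hy
      unfold gaussKer
      have e1 : (r ^ 2) ^ (-(n : ℝ) / 2) = (r ^ n)⁻¹ := by
        rw [← rpow_natCast r 2, ← rpow_mul hr.le, ← rpow_natCast r n, ← rpow_neg hr.le]
        congr 1; push_cast; ring
      rw [← hn, e1]
      have e2 : exp (-π) ≤ exp (-(π * ‖x - y‖ ^ 2 / r ^ 2)) := by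
        gcongr
        rw [div_le_iff₀ (by positivity)]
        gcongr
      calc (1 : ℝ) = exp π * r ^ n * ((r ^ n)⁻¹ * exp (-π)) := by
            rw [exp_neg]; field_simp
        _ ≤ _ := by gcongr
    · rw [indicator_of_notMem hy]; exact zero_le
  unfold ballAvg
  rw [hvol]
  refine ENNReal.div_le_of_le_mul (hν.trans_eq ?_)
  rw [← ENNReal.ofReal_mul (by positivity), ← ENNReal.ofReal_mul
    (mul_nonneg (ballConst_pos n).le (gaussAvg_nonneg ν (by positivity) x))]
  congr 1
  rw [ballConst, ← hw]
  field_simp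

lemma Grass.nontrivial {d n : ℕ} (hn : 0 < n) (V : Grass d n) : Nontrivial V.1 :=
  Module.nontrivial_of_finrank_pos (R := ℝ) (by rw [V.2]; exact hn)

lemma projMeasure_univ {d : ℕ} (V : Submodule ℝ (Euc d)) (μ : Measure (Euc d)) :
    projMeasure V μ univ = μ univ := by
  rw [projMeasure, Measure.map_apply V.orthogonalProjectionOnto.continuous.measurable
    MeasurableSet.univ, preimage_univ]

/-- The volume of an `r`-ball in `V` depends only on `n`, and its `π_V μ`-measure is the `μ`-measure
of a slice of the closed set `S`. -/
lemma measurable_lintegral_ballAvg_projMeasure {d n : ℕ} (hn : 0 < n) (μ : Measure (Euc d))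
    [IsFiniteMeasure μ] (p r : ℝ) :
    Measurable fun V : Grass d n => ∫⁻ x, ballAvg (projMeasure V.1 μ) r x ^ p := by
  set v : ℝ≥0∞ := ENNReal.ofReal r ^ n * ENNReal.ofReal (√π ^ n / Gamma (n / 2 + 1)) with hv
  set S : Set ((Grass d n × Euc d) × Euc d) :=
    {q | dist (q.1.1.1.starProjection q.2) q.1.2 ≤ r} with hS
  have hSm : MeasurableSet S := by
    have h1 : Continuous fun q : (Grass d n × Euc d) × Euc d => q.1.1.1.starProjection q.2 :=
      Grass.continuous_starProjection_apply.comp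
        ((continuous_fst.comp continuous_fst).prodMk continuous_snd)
    exact (isClosed_le (h1.dist (continuous_snd.comp continuous_fst))
      continuous_const).measurableSet
  have hF : Measurable fun q : Grass d n × Euc d => (μ (Prod.mk q ⁻¹' S) / v) ^ p :=
    ((measurable_measure_prodMk_left hSm).div_const _).pow_const _
  convert Grass.measurable_lintegral hF using 4 with V x
  have := Grass.nontrivial hn V
  rw [ballAvg, InnerProductSpace.volume_closedBall, V.2, ← hv, projMeasure,
    Measure.map_apply V.1.orthogonalProjectionOnto.continuous.measurable measurableSet_closedBall]
  rfl

lemma projLpPow_eq_liminf {d n : ℕ} (μ : Measure (Euc d)) [IsFiniteMeasure μ] {p : ℝ}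
    (hp : 1 < p) (V : Grass d n) : projLpPow n μ p V =
      liminf (fun m => ∫⁻ x, ballAvg (projMeasure V.1 μ) (radius m) x ^ p) atTop :=
  measureLpNorm_rpow_eq_liminf _ hp

lemma measurable_projLpPow {d n : ℕ} (hn : 0 < n) (μ : Measure (Euc d)) [IsFiniteMeasure μ]
    {p : ℝ} (hp : 1 < p) : Measurable (projLpPow n μ p) := by
  have : projLpPow n μ p = fun V : Grass d n =>
      liminf (fun m => ∫⁻ x, ballAvg (projMeasure V.1 μ) (radius m) x ^ p) atTop :=
    funext fun V => projLpPow_eq_liminf μ hp V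
  rw [this]
  exact Measurable.liminf fun m => measurable_lintegral_ballAvg_projMeasure hn μ p _

/-! ### The main estimates. -/

/-- The average Sobolev norms of the projections of a Frostman measure. -/
lemma exists_lintegral_sobolevNorm_le {d n : ℕ} (hn : 0 < n) (hnd : n < d) {s σ R : ℝ}
    (hσ : 0 ≤ σ) (hσs : n + 2 * σ < s) (hσd : n + 2 * σ < d) (hR : 0 < R) :
    ∃ A : ℝ, 0 < A ∧ ∀ (μ : Measure (Euc d)) [IsFiniteMeasure μ] (C : ℝ), 0 ≤ C →
      IsFrostman μ s C → μ (closedBall 0 R)ᶜ = 0 →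
      ∫⁻ V : Grass d n, sobolevNorm (projMeasure V.1 μ) σ ∂(grassMeasure hnd.le) ≤
        ENNReal.ofReal (A * C ^ 2) := by
  obtain ⟨c, hc, hcH⟩ := exists_lintegral_grassMeasure_le hn hnd.le
  have hn' : (0 : ℝ) < n := by exact_mod_cast hn
  have hnd' : (n : ℝ) < d := by exact_mod_cast hnd
  obtain ⟨A, hA, hAμ⟩ := exists_lintegral_rpow_mul_specPow_le d (s := s) (β := d - n - 2 * σ)
    (R := R) (by linarith) (by linarith) (by linarith) hR
  refine ⟨c.toReal * A + 1, by positivity, fun μ _ C hC hF hsupp => ?_⟩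
  have hm : Measurable fun ξ : Euc d => ENNReal.ofReal (‖ξ‖ ^ (2 * σ) * specPow μ ξ) := by
    have := measurable_specPow μ
    fun_prop
  calc _ = ∫⁻ V : Grass d n, (∫⁻ ξ : V.1, ENNReal.ofReal (‖(ξ : Euc d)‖ ^ (2 * σ) *
        specPow μ (ξ : Euc d))) ∂(grassMeasure hnd.le) := by
        refine lintegral_congr fun V => lintegral_congr fun ξ => ?_
        rw [specPow_projMeasure]
        rfl
    _ ≤ c * ∫⁻ ξ : Euc d, ENNReal.ofReal (‖ξ‖ ^ ((n : ℝ) - d)) *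
        ENNReal.ofReal (‖ξ‖ ^ (2 * σ) * specPow μ ξ) := hcH _ hm
    _ ≤ c * ∫⁻ ξ : Euc d, ENNReal.ofReal (‖ξ‖ ^ (-(d - n - 2 * σ)) * specPow μ ξ) := by
        gcongr with ξ
        rw [← ENNReal.ofReal_mul (by positivity)]
        refine ENNReal.ofReal_le_ofReal ?_
        rw [← mul_assoc]
        refine mul_le_mul_of_nonneg_right ?_ (specPow_nonneg μ ξ)
        -- At `ξ = 0` the power `0 ^ (n - d)` is `0` by convention, so the inequality still holds.
        rcases (norm_nonneg ξ).eq_or_lt with h | h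
        · rw [← h, zero_rpow (by linarith : (n : ℝ) - d ≠ 0), zero_mul]
          positivity
        · rw [← rpow_add h]
          exact le_of_eq (by congr 1; ring)
    _ ≤ c * ENNReal.ofReal (A * C ^ 2) := by
        gcongr
        exact hAμ μ C hC hF hsupp
    _ ≤ _ := by
        rw [← ENNReal.ofReal_toReal hc, ← ENNReal.ofReal_mul (by positivity),
          ENNReal.toReal_ofReal (by positivity)]
        refine ENNReal.ofReal_le_ofReal ?_
        nlinarith [sq_nonneg C]

/-- The main estimate for `s < d`. -/
theorem exists_lintegral_projLpPow_le_of_lt {d n : ℕ} (hn : 0 < n) (hnd : n < d) {s p R : ℝ}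
    (hs : n < s) (hsd : s < d) (hp : 2 ≤ p) (hps : (p - 2) * (d - s) < s - n) (hR : 0 < R) :
    ∃ A : ℝ, 0 < A ∧ ∀ (μ : Measure (Euc d)) [IsFiniteMeasure μ] (C : ℝ), 0 < C →
      IsFrostman μ s C → μ (closedBall 0 R)ᶜ = 0 →
      ∫⁻ V, projLpPow n μ p V ∂(grassMeasure hnd.le) ≤ ENNReal.ofReal (A * C ^ p) := by
  set κ : ℝ := d - s with hκ
  have hκpos : 0 < κ := by rw [hκ]; linarith
  -- The lower bound makes the interpolation converge; the upper one makes the energy of order `n +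
  -- 2σ` finite.
  obtain ⟨σ, hσ1, hσ2⟩ := exists_between (show κ * (p - 2) / 2 < (s - n) / 2 by linarith)
  have hσ0 : 0 ≤ σ := le_trans (by have : 0 ≤ p - 2 := by linarith
                                   positivity) hσ1.le
  have hn' : (0 : ℝ) < n := by exact_mod_cast hn
  obtain ⟨c, hc, hcF⟩ := exists_gaussAvg_le_of_isFrostman d s
  -- Differences of order `N = d` suffice, as `σ < (s-n)/2 < 2d`.
  obtain ⟨A₁, hA₁, hint⟩ := exists_lintegral_gaussAvg_rpow_le d (p := p) (by linarith) hκpos hσ0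
    hσ1 (by linarith) (hn.trans hnd)
  obtain ⟨A₂, hA₂, hsob⟩ := exists_lintegral_sobolevNorm_le hn hnd (s := s) hσ0 (by linarith)
    (by linarith) hR
  set k : ℝ := 2 ^ ((d : ℝ) / 2) * exp (π * R ^ 2) * c with hk
  have hkpos : 0 < k := by positivity
  have hb := ballConst_pos n
  set b : ℝ := ballConst n ^ p with hbdef
  have hbpos : 0 < b := by positivity
  refine ⟨b * (A₁ * k ^ (p - 1) * R ^ s + A₁ * k ^ (p - 2) * A₂), by positivity, ?_⟩
  intro μ _ C hC hF hsupp
  have hsup : ∀ V : Grass d n, ∀ a, 0 < a → a ≤ 1 → ∀ z,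
      gaussAvg (projMeasure V.1 μ) a z ≤ k * C * a ^ (-κ / 2) := by
    intro V a ha ha1 z
    refine (gaussAvg_projMeasure_le V.1 μ ha ha1 hsupp (hcF μ C hC.le hF a ha) z).trans_eq ?_
    have : (s - d) / 2 = -κ / 2 := by rw [hκ]; ring
    rw [this, hk]; ring
  have hmass : μ univ ≤ ENNReal.ofReal (C * R ^ s) := by
    rw [← ENNReal.ofReal_toReal (measure_ne_top μ univ)]
    exact ENNReal.ofReal_le_ofReal (measureReal_univ_le_of_isFrostman hR hC.le hF hsupp)
  have hΦ : ∀ m, 1 ≤ m → ∀ V : Grass d n,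
      ∫⁻ x, ballAvg (projMeasure V.1 μ) (radius m) x ^ p ≤
        ENNReal.ofReal b * (ENNReal.ofReal (A₁ * (k * C) ^ (p - 1)) * μ univ +
          ENNReal.ofReal (A₁ * (k * C) ^ (p - 2)) * sobolevNorm (projMeasure V.1 μ) σ) := by
    intro m hm V
    have := Grass.nontrivial hn V
    have hr := radius_pos m
    have hr2 : radius m ≤ 1 / 2 := by
      unfold radius
      have : (1 : ℝ) ≤ m := by exact_mod_cast hm
      gcongr
      linarith
    have hτ : radius m ^ 2 ≤ 1 / 2 := by nlinarith
    rw [← projMeasure_univ V.1 μ]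
    refine le_trans ?_ (mul_le_mul_right (hint (projMeasure V.1 μ) (k * C) (by positivity)
      (hsup V) (radius m ^ 2) (by positivity) hτ) _)
    rw [← lintegral_const_mul' _ _ ENNReal.ofReal_ne_top]
    refine lintegral_mono fun x => ?_
    have h0 := gaussAvg_nonneg (projMeasure V.1 μ) (a := radius m ^ 2) (by positivity) x
    calc _ ≤ ENNReal.ofReal (ballConst n * gaussAvg (projMeasure V.1 μ) (radius m ^ 2) x) ^ p := by
          gcongr
          have := ballAvg_le_gaussAvg (projMeasure V.1 μ) hr x
          rwa [V.2] at this
      _ = _ := by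
          rw [ENNReal.ofReal_rpow_of_nonneg (by positivity) (by linarith),
            mul_rpow hb.le h0, ENNReal.ofReal_mul hbpos.le]
  calc ∫⁻ V, projLpPow n μ p V ∂(grassMeasure hnd.le)
      = ∫⁻ V : Grass d n, liminf (fun m => ∫⁻ x, ballAvg (projMeasure V.1 μ) (radius m) x ^ p)
          atTop ∂(grassMeasure hnd.le) :=
        lintegral_congr fun V => projLpPow_eq_liminf μ (by linarith) V
    _ ≤ liminf (fun m => ∫⁻ V : Grass d n, (∫⁻ x, ballAvg (projMeasure V.1 μ) (radius m) x ^ p)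
          ∂(grassMeasure hnd.le)) atTop :=
        lintegral_liminf_le fun m => measurable_lintegral_ballAvg_projMeasure hn μ p _
    _ ≤ ENNReal.ofReal b * (ENNReal.ofReal (A₁ * (k * C) ^ (p - 1)) * μ univ +
          ENNReal.ofReal (A₁ * (k * C) ^ (p - 2)) * ENNReal.ofReal (A₂ * C ^ 2)) := by
        refine liminf_le_of_frequently_le' ((eventually_ge_atTop 1).mono fun m hm => ?_).frequently
        refine (lintegral_mono (hΦ m hm)).trans ?_
        rw [lintegral_const_mul' _ _ ENNReal.ofReal_ne_top, lintegral_add_left measurable_const,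
          lintegral_const, measure_univ (μ := grassMeasure hnd.le), mul_one,
          lintegral_const_mul' _ _ ENNReal.ofReal_ne_top]
        gcongr
        exact hsob μ C hC.le hF hsupp
    _ ≤ ENNReal.ofReal b * (ENNReal.ofReal (A₁ * (k * C) ^ (p - 1)) * ENNReal.ofReal (C * R ^ s) +
          ENNReal.ofReal (A₁ * (k * C) ^ (p - 2)) * ENNReal.ofReal (A₂ * C ^ 2)) := by
        gcongr
    _ = _ := by
        rw [← ENNReal.ofReal_mul (by positivity), ← ENNReal.ofReal_mul (by positivity),
          ← ENNReal.ofReal_add (by positivity) (by positivity), ← ENNReal.ofReal_mul hbpos.le]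
        congr 1
        -- Both terms are homogeneous of degree `p` in `C`: mass contributes `C` to `C^(p-1)`,
        -- energy `C²` to `C^(p-2)`.
        have e1 : C ^ p = C ^ (p - 1) * C := by rw [← rpow_add_one hC.ne', sub_add_cancel]
        have e2 : C ^ (p - 1) * C = C ^ (p - 2) * C ^ 2 := by
          rw [← e1, ← rpow_two, ← rpow_add hC]
          congr 1; ring
        rw [mul_rpow hkpos.le hC.le, mul_rpow hkpos.le hC.le, e1]
        linear_combination (-b * A₁ * k ^ (p - 2) * A₂) * e2

/-- For `r ≤ R` the surplus `r^(s-s')` is at most `R^(s-s')`; for `r > R` the total mass bound `C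
R^s` suffices. -/
lemma IsFrostman.mono_exponent {d : ℕ} {μ : Measure (Euc d)} [IsFiniteMeasure μ]
    {s s' R C : ℝ} (hF : IsFrostman μ s C) (hC : 0 ≤ C) (hR : 0 < R) (hs' : 0 ≤ s') (h : s' ≤ s)
    (hsupp : μ (closedBall 0 R)ᶜ = 0) : IsFrostman μ s' (C * R ^ (s - s')) := by
  intro x r hr
  rcases le_or_gt r R with hrR | hrR
  · refine (hF x r hr).trans (ENNReal.ofReal_le_ofReal ?_)
    calc C * r ^ s = C * r ^ (s - s') * r ^ s' := by
          rw [mul_assoc, ← rpow_add hr, sub_add_cancel]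
      _ ≤ _ := by gcongr
  · refine (measure_mono (subset_univ _)).trans ?_
    rw [← ENNReal.ofReal_toReal (measure_ne_top μ univ)]
    refine ENNReal.ofReal_le_ofReal
      ((measureReal_univ_le_of_isFrostman hR hC hF hsupp).trans ?_)
    calc C * R ^ s = C * R ^ (s - s') * R ^ s' := by
          rw [mul_assoc, ← rpow_add hR, sub_add_cancel]
      _ ≤ _ := by gcongr

/-- The main estimate, for measures with support in a fixed ball. -/
theorem exists_lintegral_projLpPow_le {d n : ℕ} (hn : 0 < n) (hnd : n < d) {s p R : ℝ}
    (hs : n < s) (hp : 2 ≤ p) (hps : s < d → p < (2 * d - n - s) / (d - s)) (hR : 0 < R) :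
    ∃ A : ℝ, 0 < A ∧ ∀ (μ : Measure (Euc d)) [IsFiniteMeasure μ] (C : ℝ), 0 < C →
      IsFrostman μ s C → μ (closedBall 0 R)ᶜ = 0 →
      ∫⁻ V, projLpPow n μ p V ∂(grassMeasure hnd.le) ≤ ENNReal.ofReal (A * C ^ p) := by
  rcases lt_or_ge s d with hsd | hsd
  · have h := hps hsd
    rw [lt_div_iff₀ (by linarith)] at h
    exact exists_lintegral_projLpPow_le_of_lt hn hnd hs hsd hp (by linarith) hR
  · have hn' : (0 : ℝ) < n := by exact_mod_cast hn
    have hnd' : (0 : ℝ) < d - n := by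
      have : (n : ℝ) < d := by exact_mod_cast hnd
      linarith
    -- For the exponent `d - ε` the condition reads `(p-2) ε < d - ε - n`, that is `(p-1) ε < d -
    -- n`.
    set ε : ℝ := (d - n) / (2 * p) with hε
    have hεpos : 0 < ε := by positivity
    have h2 : 2 * p * ε = d - n := by rw [hε]; field_simp
    have hεn : ε < d - n := by nlinarith
    obtain ⟨A, hA, hAμ⟩ := exists_lintegral_projLpPow_le_of_lt hn hnd (s := d - ε) (p := p)
      (by linarith) (by linarith) hp (by nlinarith) hR
    set t : ℝ := R ^ (s - (d - ε)) with ht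
    have htpos : 0 < t := by positivity
    refine ⟨A * t ^ p, by positivity, fun μ _ C hC hF hsupp => ?_⟩
    have := hAμ μ (C * t) (by positivity)
      (hF.mono_exponent hC.le hR (by linarith) (by linarith) hsupp) hsupp
    rw [mul_rpow hC.le htpos.le] at this
    convert this using 2
    ring

lemma measure_compl_closedBall_eq_zero {d : ℕ} {μ : Measure (Euc d)} {R : ℝ}
    (h : μ.support ⊆ closedBall 0 R) : μ (closedBall 0 R)ᶜ = 0 :=
  measure_mono_null (compl_subset_compl.2 h) measure_compl_support

lemma isFiniteMeasure_of_support_subset {d : ℕ} {μ : Measure (Euc d)} [IsLocallyFiniteMeasure μ]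
    {R : ℝ} (h : μ.support ⊆ closedBall 0 R) : IsFiniteMeasure μ := by
  refine ⟨?_⟩
  rw [← union_compl_self (closedBall (0 : Euc d) R)]
  refine (measure_union_le _ _).trans_lt ?_
  rw [measure_compl_closedBall_eq_zero h, add_zero]
  exact (isCompact_closedBall _ _).measure_lt_top

lemma projLpPow_le_of_le_two {d n : ℕ} (μ : Measure (Euc d)) [IsFiniteMeasure μ] {p : ℝ}
    (hp : 1 ≤ p) (hp2 : p ≤ 2) (V : Grass d n) :
    projLpPow n μ p V ≤ μ univ + projLpPow n μ 2 V := by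
  have := measureLpNorm_rpow_le (projMeasure V.1 μ) hp hp2
  rwa [projMeasure_univ] at this

/-- A finite `L²` norm forces absolute continuity. This settles measurability at `p = 1`, which the
`liminf` formula does not cover. -/
lemma projLpPow_one_eq_of_ne_top {d n : ℕ} (μ : Measure (Euc d)) [IsFiniteMeasure μ]
    {V : Grass d n} (hV : projLpPow n μ 2 V ≠ ∞) : projLpPow n μ 1 V = μ univ := by
  have hac : projMeasure V.1 μ ≪ volume := by
    by_contra hac
    exact hV (measureLpNorm_rpow_of_not_ac _ two_pos hac)
  have := measureLpNorm_one_of_ac _ hac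
  rwa [projMeasure_univ] at this

end

theorem theorem1p2 (d : ℕ) (s p : ℝ) :
    (1 ≤ p →
      ∀ (n : ℕ) (_ : 0 < n) (hnd : n < d), (n : ℝ) < s →
        (s < d → p < (2 * d - n - s) / (d - s)) →
        ∀ (μ : Measure (Euc d)) [IsLocallyFiniteMeasure μ],
          IsCompact μ.support → (∃ C : ℝ, 0 < C ∧ IsFrostman μ s C) →
            AEMeasurable (projLpPow n μ p) (grassMeasure hnd.le) ∧
            ∫⁻ V, projLpPow n μ p V ∂(grassMeasure hnd.le) < ∞) ∧
    (2 ≤ p →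
      ∃ A : ℝ, 0 < A ∧ ∀ (n : ℕ) (_ : 0 < n) (hnd : n < d), (n : ℝ) < s →
        (s < d → p < (2 * d - n - s) / (d - s)) →
        ∀ (μ : Measure (Euc d)) [IsLocallyFiniteMeasure μ],
          μ.support ⊆ closedBall 0 1 → ∀ C : ℝ, 0 < C → IsFrostman μ s C →
            ∫⁻ V, projLpPow n μ p V ∂(grassMeasure hnd.le) ≤ ENNReal.ofReal (A * C ^ p)) := by
  constructor
  · intro hp n hn hnd hs hps μ _ hcpt ⟨C, hC, hF⟩
    obtain ⟨R₀, hR₀⟩ := hcpt.isBounded.subset_closedBall 0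
    have hsub : μ.support ⊆ closedBall 0 (max R₀ 1) :=
      hR₀.trans (closedBall_subset_closedBall (le_max_left _ _))
    have hR : 0 < max R₀ 1 := lt_max_of_lt_right one_pos
    have hsupp := measure_compl_closedBall_eq_zero hsub
    have := isFiniteMeasure_of_support_subset hsub
    -- `p* - 2 = (s-n)/(d-s) > 0`, so the exponent `2` is always admissible.
    have hps2 : s < d → 2 < (2 * d - n - s) / (d - s) := fun h => by
      rw [lt_div_iff₀ (by linarith)]; linarith
    have hfin : ∀ q : ℝ, 2 ≤ q → (s < d → q < (2 * d - n - s) / (d - s)) →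
        ∫⁻ V, projLpPow n μ q V ∂(grassMeasure hnd.le) < ∞ := fun q hq hqs => by
      obtain ⟨A, -, hA⟩ := exists_lintegral_projLpPow_le hn hnd hs hq hqs hR
      exact (hA μ C hC hF hsupp).trans_lt ENNReal.ofReal_lt_top
    have hfin2 := hfin 2 le_rfl hps2
    constructor
    · rcases hp.eq_or_lt with rfl | hp
      · refine ⟨fun _ => μ Set.univ, measurable_const, ?_⟩
        filter_upwards [ae_lt_top (measurable_projLpPow hn μ one_lt_two) hfin2.ne] with V hV
        exact projLpPow_one_eq_of_ne_top μ hV.ne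
      · exact (measurable_projLpPow hn μ hp).aemeasurable
    · rcases le_total 2 p with hp2 | hp2
      · exact hfin p hp2 hps
      · refine (lintegral_mono fun V => projLpPow_le_of_le_two μ hp hp2 V).trans_lt ?_
        rw [lintegral_add_left measurable_const, lintegral_const,
          measure_univ (μ := grassMeasure hnd.le), mul_one]
        exact ENNReal.add_lt_top.2 ⟨measure_lt_top μ _, hfin2⟩
  · intro hp
    -- The final constant may not depend on `n`. Each `n` gets its own, a dummy `1` where the
    -- hypotheses fail, and the sum over `n ≤ d` serves for all.
    have key : ∀ n : ℕ, ∃ A : ℝ, 0 < A ∧ ∀ (_ : 0 < n) (hnd : n < d), (n : ℝ) < s →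
        (s < d → p < (2 * d - n - s) / (d - s)) →
        ∀ (μ : Measure (Euc d)) [IsLocallyFiniteMeasure μ],
          μ.support ⊆ closedBall 0 1 → ∀ C : ℝ, 0 < C → IsFrostman μ s C →
            ∫⁻ V, projLpPow n μ p V ∂(grassMeasure hnd.le) ≤ ENNReal.ofReal (A * C ^ p) := by
      intro n
      by_cases h : 0 < n ∧ n < d ∧ (n : ℝ) < s ∧ (s < d → p < (2 * d - n - s) / (d - s))
      · obtain ⟨hn, hnd, hs, hps⟩ := h
        obtain ⟨A, hA, hAμ⟩ := exists_lintegral_projLpPow_le hn hnd hs hp hps one_pos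
        refine ⟨A, hA, fun _ _ _ _ μ _ hsub C hC hF => ?_⟩
        have := isFiniteMeasure_of_support_subset hsub
        exact hAμ μ C hC hF (measure_compl_closedBall_eq_zero hsub)
      · exact ⟨1, one_pos, fun hn hnd hs hps => absurd ⟨hn, hnd, hs, hps⟩ h⟩
    choose A hA hAμ using key
    refine ⟨∑ n ∈ Finset.range (d + 1), A n,
      Finset.sum_pos (fun n _ => hA n) (by simp), fun n hn hnd hs hps μ _ hsub C hC hF => ?_⟩
    refine (hAμ n hn hnd hs hps μ hsub C hC hF).trans (ENNReal.ofReal_le_ofReal ?_)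
    gcongr
    exact Finset.single_le_sum (f := A) (fun i _ => (hA i).le) (Finset.mem_range.2 (by omega))
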